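/- Let $p,q$ be nonnegative integers, $A_1,\dots,A_p>0$, $B_1,\dots,B_q>0$, $a_1,\dots,a_p,b_1,\dots,b_q\in\mathbb{R}$ with $\sum_{j}B_j=\sum_{k}A_k$, and put $$W(x)=\frac{\prod_{k=1}^p\Gamma(A_kx+a_k)}{\prod_{j=1}^q\Gamma(B_jx+b_j)},\qquad \rho=\prod_{k=1}^pA_k^{A_k}\prod_{j=1}^qB_j^{-B_j},\qquad \mu=\sum_{j=1}^qb_j-\sum_{k=1}^pa_k+\frac{p-q}{2},$$ $$\nu=(2\pi)^{(p-q)/2}\prod_{k=1}^pA_k^{a_k-1/2}\prod_{j=1}^qB_j^{1/2-b_j}.$$ For $0<x<\rho$ let $$H(x)=\frac{1}{2\pi i}\int_{\mathcal L}\frac{\prod_{k=1}^p\Gamma(A_ks+a_k)}{\prod_{j=1}^q\Gamma(B_js+b_j)}\,x^{-s}\,ds$$ be the delta neutral Fox function $H^{p,0}_{q,p}$, where $\mathcal L$ is a left loop: for some reals $\varphi_1<0<\varphi_2$ and $c$ with $c>-a_k/A_k$ for all $k$, it consists of the horizontal ray from $-\infty+i\varphi_1$ to $c+i\varphi_1$,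 the segment from $c+i\varphi_1$ to $c+i\varphi_2$ and the horizontal ray from $c+i\varphi_2$ to $-\infty+i\varphi_2$. Suppose that $\mu=0$, that $\rho\le 1$, and that $W$ (with removable singularities, if any, filled in) is completely monotonic on $(0,\infty)$, i.e. $W$ is smooth with values in $(0,\infty)$ and $(-1)^nW^{(n)}(x)\ge 0$ for all $x>0$, $n\ge 0$. Then, for every such loop $\mathcal L$, $H$ is real and nonnegative on $(0,\rho)$, and the representing measure of $W$ in Bernstein's theorem is $$d\nu(t)=\nu\,\delta_{-\log\rho}(t)+H(e^{-t})\,dt\quad\text{on }[-\log\rho,\infty),$$ where $\delta_w$ is the unit mass at $w$. That is, for all $x>0$ $$W(x)=\int_{[-\log\rho,\infty)}e^{-xt}\,d\nu(t)$$ with an absolutely convergent integral, and $d\nu$ is the only nonnegative measure on $[0,\infty)$ whose Laplace transform is $W$ on $(0,\infty)$. -/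

import Mathlib

open scoped ContDiff

namespace FoxH

noncomputable section

/-- The gamma ratio `∏ₖ Γ(Aₖ s + aₖ) / ∏ⱼ Γ(Bⱼ s + bⱼ)` of a complex variable. (Where a gamma
function in the denominator has a pole, Mathlib's value `0` for it and division by `0` give the
value `0`, which is the usual convention for `1/Γ`.) -/
def gammaRatioC {p q : ℕ} (A a : Fin p → ℝ) (B b : Fin q → ℝ) (s : ℂ) : ℂ :=
  (∏ k, Complex.Gamma ((A k : ℂ) * s + (a k : ℂ))) /
    ∏ j, Complex.Gamma ((B j : ℂ) * s + (b j : ℂ))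

/-- The gamma ratio `∏ₖ Γ(Aₖ x + aₖ) / ∏ⱼ Γ(Bⱼ x + bⱼ)` of a real variable. -/
def gammaRatio {p q : ℕ} (A a : Fin p → ℝ) (B b : Fin q → ℝ) (x : ℝ) : ℝ :=
  (∏ k, Real.Gamma (A k * x + a k)) / ∏ j, Real.Gamma (B j * x + b j)

/-- `ρ = ∏ₖ Aₖ ^ Aₖ * ∏ⱼ Bⱼ ^ (-Bⱼ)`. -/
def rho {p q : ℕ} (A : Fin p → ℝ) (B : Fin q → ℝ) : ℝ :=
  (∏ k, A k ^ A k) * ∏ j, B j ^ (-B j)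

/-- `μ = ∑ⱼ bⱼ - ∑ₖ aₖ + (p - q) / 2`. -/
def mu {p q : ℕ} (a : Fin p → ℝ) (b : Fin q → ℝ) : ℝ :=
  (∑ j, b j) - (∑ k, a k) + ((p : ℝ) - (q : ℝ)) / 2

/-- `ν = (2π) ^ ((p - q) / 2) * ∏ₖ Aₖ ^ (aₖ - 1/2) * ∏ⱼ Bⱼ ^ (1/2 - bⱼ)`. -/
def nu {p q : ℕ} (A a : Fin p → ℝ) (B b : Fin q → ℝ) : ℝ :=
  (2 * Real.pi) ^ (((p : ℝ) - (q : ℝ)) / 2) *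
    (∏ k, A k ^ (a k - 1 / 2)) * ∏ j, B j ^ (1 / 2 - b j)

/-- The integral `∫ f(s) ds` over the left loop which starts at `-∞ + i φ₁`, runs along a
horizontal ray to `c + i φ₁`, then along a vertical segment to `c + i φ₂`, and returns along a
horizontal ray to `-∞ + i φ₂`. -/
def leftLoopIntegral (c φ₁ φ₂ : ℝ) (f : ℂ → ℂ) : ℂ :=
  (∫ u in Set.Iic c, f ((u : ℂ) + (φ₁ : ℂ) * Complex.I)) +
    (∫ v in φ₁..φ₂, f ((c : ℂ) + (v : ℂ) * Complex.I) * Complex.I) -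
    ∫ u in Set.Iic c, f ((u : ℂ) + (φ₂ : ℂ) * Complex.I)

/-- Fox's function `H^{p,0}_{q,p}(x | (B, b); (A, a))` in the delta neutral case, for
`0 < x < ρ`: the Mellin-Barnes integral `(2πi)⁻¹ ∫_L ∏ₖ Γ(Aₖ s + aₖ) / ∏ⱼ Γ(Bⱼ s + bⱼ) x^{-s} ds`
over a left loop `L`. The loop leaves all the poles of the integrand, which are real and at most
`maxₖ (-aₖ / Aₖ)`, on its left when `φ₁ < 0 < φ₂` and `-aₖ / Aₖ < c` for all `k`; by Cauchy's
theorem the value is the same for all such `c`, `φ₁`, `φ₂`. -/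
def foxH (c φ₁ φ₂ : ℝ) {p q : ℕ} (A a : Fin p → ℝ) (B b : Fin q → ℝ) (x : ℝ) : ℂ :=
  (2 * (Real.pi : ℂ) * Complex.I)⁻¹ *
    leftLoopIntegral c φ₁ φ₂ fun s => gammaRatioC A a B b s * (x : ℂ) ^ (-s)

/-- `f` is completely monotonic on `(0, ∞)`, as a function with values in `(0, ∞)`. Only the
values of `f` on `(0, ∞)` matter. -/
def IsCompletelyMonotonic (f : ℝ → ℝ) : Prop :=
  (∀ x : ℝ, 0 < x → 0 < f x) ∧ ContDiffOn ℝ ∞ f (Set.Ioi 0) ∧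
    ∀ (n : ℕ) (x : ℝ), 0 < x → 0 ≤ (-1 : ℝ) ^ n * iteratedDeriv n f x

/-- The measure `ν δ_{-log ρ} + H(e^{-t}) dt` on `[-log ρ, ∞)`, regarded as a measure on `ℝ`
that vanishes outside that half-line. It is the intended measure when `H` is real and
nonnegative on `(0, ρ)`. -/
def reprMeasure (c φ₁ φ₂ : ℝ) {p q : ℕ} (A a : Fin p → ℝ) (B b : Fin q → ℝ) :
    MeasureTheory.Measure ℝ :=
  ENNReal.ofReal (nu A a B b) • MeasureTheory.Measure.dirac (-Real.log (rho A B)) +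
    (MeasureTheory.volume.restrict (Set.Ici (-Real.log (rho A B)))).withDensity
      fun t => ENNReal.ofReal (foxH c φ₁ φ₂ A a B b (Real.exp (-t))).re

end

end FoxH

/-!
By Stirling's formula, `W s = ρ ^ s * (ν + G s)`, where `G` is `O(1 / Im s)` off every strip about
the real axis and `O(1 / Re s)` to the right. Here `H(e^{-t})` is the inverse Laplace transform of
`W` along the loop. The entire function `ν * ρ ^ s` does not contribute to it, and for `G` the loop
can be opened to a vertical line. Laplace inversion then shows that, for large `x`, `W x` is the
Laplace transform of `ν δ_{-log ρ} + H(e^{-t}) dt`, where `H` might still be complex.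

The density is recovered from the derivatives of `W` at large arguments by the inversion formula of
Post and Widder, so that complete monotonicity makes it nonnegative. The Laplace transform of a
nonnegative measure converges as far to the left as its derivatives alternate in sign (Landau), and
the identity theorem propagates the representation from large `x` to all of `(0, ∞)`. Uniqueness
holds because the Laplace transform of `m` on the line `Re s = 1` is the characteristic function of
`e^{-t} dm(t)`.
-/

namespace FoxH

open Complex Filter Topology MeasureTheory ProbabilityTheory Asymptotics Bornology Finset
open scoped ComplexOrder

/-! ### Binet's function and Stirling's formula -/

lemma add_ofReal_mem_slitPlane {z : ℂ} (hz : z ∈ slitPlane) {t : ℝ} (ht : 0 ≤ t) :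
    z + t ∈ slitPlane := by
  rw [mem_slitPlane_iff] at hz ⊢
  simp only [add_re, ofReal_re, add_im, ofReal_im, add_zero]
  exact hz.imp_left fun h => by linarith

lemma add_natCast_mem_slitPlane {z : ℂ} (hz : z ∈ slitPlane) (n : ℕ) : z + n ∈ slitPlane := by
  simpa using add_ofReal_mem_slitPlane hz (Nat.cast_nonneg (α := ℝ) n)

lemma sq_norm_add_ofReal (z : ℂ) (t : ℝ) : ‖z + t‖ ^ 2 = (z.re + t) ^ 2 + z.im ^ 2 := by
  rw [← normSq_eq_norm_sq, normSq_apply]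
  simp only [add_re, ofReal_re, add_im, ofReal_im, add_zero]
  ring

lemma hasDerivAt_ofReal (t : ℝ) : HasDerivAt (fun t : ℝ => (t : ℂ)) 1 t :=
  (hasDerivAt_id _).comp_ofReal

/-- The general term of Gudermann's series for the remainder in Stirling's formula. -/
noncomputable def gudermannTerm (z : ℂ) : ℂ :=
  (z + 1 / 2) * (log (z + 1) - log z) - 1

lemma gudermannTerm_eq_integral {z : ℂ} (hz : z ∈ slitPlane) :
    gudermannTerm z = ∫ t in (0 : ℝ)..1, ((t : ℂ) * (1 - t) / 2) / (z + t) ^ 2 := by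
  have hs : ∀ t ∈ Set.uIcc (0 : ℝ) 1, z + t ∈ slitPlane := fun t ht =>
    add_ofReal_mem_slitPlane hz (by rw [Set.uIcc_of_le zero_le_one] at ht; exact ht.1)
  have hderiv : ∀ t ∈ Set.uIcc (0 : ℝ) 1,
      HasDerivAt (fun t : ℝ => -((t : ℂ) * (1 - t) / 2) / (z + t) + (z + 1 / 2) * log (z + t) - t)
        (((t : ℂ) * (1 - t) / 2) / (z + t) ^ 2) t := by
    intro t ht
    have hid := hasDerivAt_ofReal t
    have hne : z + t ≠ 0 := slitPlane_ne_zero (hs t ht)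
    have hlog := (hid.const_add z).clog_real (hs t ht)
    have hdiv := (((hid.mul (hid.const_sub 1)).div_const 2).neg).div (hid.const_add z) hne
    refine ((hdiv.add (hlog.const_mul (z + 1 / 2))).sub hid).congr_deriv ?_
    simp only [Pi.neg_apply, Pi.mul_apply]
    field_simp
    ring
  rw [intervalIntegral.integral_eq_sub_of_hasDerivAt hderiv]
  · simp [gudermannTerm]; ring
  · refine ContinuousOn.intervalIntegrable fun t ht => ContinuousAt.continuousWithinAt ?_
    have hne : (z + t) ^ 2 ≠ 0 := pow_ne_zero _ (slitPlane_ne_zero (hs t ht))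
    exact ContinuousAt.div (by fun_prop) (by fun_prop) hne

lemma norm_gudermannTerm_le {z : ℂ} (hz : z ∈ slitPlane) {P P' : ℝ → ℝ}
    (hP : ∀ t ∈ Set.Icc (0 : ℝ) 1, HasDerivAt P (P' t) t)
    (hc : ContinuousOn P' (Set.Icc 0 1))
    (hle : ∀ t ∈ Set.Icc (0 : ℝ) 1, ((z.re + t) ^ 2 + z.im ^ 2)⁻¹ ≤ P' t) :
    ‖gudermannTerm z‖ ≤ P 1 - P 0 := by
  have hu : Set.uIcc (0 : ℝ) 1 = Set.Icc 0 1 := Set.uIcc_of_le zero_le_one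
  have hi : IntervalIntegrable P' MeasureTheory.volume 0 1 :=
    ContinuousOn.intervalIntegrable (by rwa [hu])
  rw [gudermannTerm_eq_integral hz,
    ← intervalIntegral.integral_eq_sub_of_hasDerivAt (by rwa [hu]) hi]
  refine intervalIntegral.norm_integral_le_of_norm_le zero_le_one
    (Eventually.of_forall fun t ht => ?_) hi
  refine le_trans ?_ (hle t ⟨ht.1.le, ht.2⟩)
  have hnonneg : 0 ≤ t * (1 - t) := mul_nonneg ht.1.le (sub_nonneg.2 ht.2)
  have hcast : (t : ℂ) * (1 - t) / 2 = ((t * (1 - t) / 2 : ℝ) : ℂ) := by push_cast; ring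
  rw [norm_div, norm_pow, hcast, norm_real, Real.norm_of_nonneg (by positivity), ← one_div,
    sq_norm_add_ofReal]
  gcongr
  nlinarith [ht.1, ht.2, sq_nonneg (t - 1)]

lemma norm_gudermannTerm_le_arctan {z : ℂ} (hz : z.im ≠ 0) :
    ‖gudermannTerm z‖ ≤ |z.im|⁻¹ * Real.arctan ((z.re + 1) / |z.im|)
      - |z.im|⁻¹ * Real.arctan (z.re / |z.im|) := by
  have : 0 < |z.im| := abs_pos.2 hz
  have h := norm_gudermannTerm_le (mem_slitPlane_iff.2 (Or.inr hz))
    (P := fun t => |z.im|⁻¹ * Real.arctan ((z.re + t) / |z.im|))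
    (P' := fun t => |z.im|⁻¹ * (1 / (1 + ((z.re + t) / |z.im|) ^ 2) * (1 / |z.im|)))
    (fun t _ => ((((hasDerivAt_id t).const_add z.re).div_const _).arctan).const_mul _) ?_ ?_
  · simpa using h
  · have hne : ∀ t : ℝ, 1 + ((z.re + t) / |z.im|) ^ 2 ≠ 0 := fun t => by positivity
    exact Continuous.continuousOn (by fun_prop (disch := exact hne _))
  · intro t _
    apply le_of_eq
    rw [← sq_abs z.im]
    field_simp
    ring

lemma norm_gudermannTerm_le_inv {z : ℂ} (hz : 0 < z.re) :
    ‖gudermannTerm z‖ ≤ z.re⁻¹ - (z.re + 1)⁻¹ := by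
  have hpos : ∀ t ∈ Set.Icc (0 : ℝ) 1, 0 < z.re + t := fun t ht => by linarith [ht.1]
  have h := norm_gudermannTerm_le (mem_slitPlane_iff.2 (Or.inl hz))
    (P := fun t => -(z.re + t)⁻¹) (P' := fun t => -(-1 / (z.re + t) ^ 2))
    (fun t ht => (((hasDerivAt_id t).const_add z.re).fun_inv (hpos t ht).ne').neg) ?_ ?_
  · simpa [add_comm, sub_eq_add_neg] using h
  · intro t ht
    have hne : (z.re + t) ^ 2 ≠ 0 := pow_ne_zero 2 (hpos t ht).ne'
    exact ContinuousAt.continuousWithinAt (by fun_prop (disch := assumption))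
  · intro t ht
    have := hpos t ht
    rw [neg_div', neg_neg, one_div]
    gcongr
    exact le_add_of_nonneg_right (sq_nonneg _)

lemma sum_norm_gudermannTerm_le_im {z : ℂ} (hz : z.im ≠ 0) (n : ℕ) :
    ∑ k ∈ range n, ‖gudermannTerm (z + k)‖ ≤ Real.pi / |z.im| := by
  set F : ℕ → ℝ := fun k => |z.im|⁻¹ * Real.arctan ((z.re + k) / |z.im|) with hF
  have hterm : ∀ k ∈ range n, ‖gudermannTerm (z + k)‖ ≤ F (k + 1) - F k := fun k _ => by
    simpa [hF, add_assoc] using norm_gudermannTerm_le_arctan (z := z + k) (by simpa using hz)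
  calc ∑ k ∈ range n, ‖gudermannTerm (z + k)‖
      ≤ ∑ k ∈ range n, (F (k + 1) - F k) := sum_le_sum hterm
    _ = |z.im|⁻¹ *
          (Real.arctan ((z.re + n) / |z.im|) - Real.arctan ((z.re + (0 : ℕ)) / |z.im|)) := by
        rw [sum_range_sub, mul_sub]
    _ ≤ |z.im|⁻¹ * Real.pi := by
        gcongr
        linarith [Real.arctan_lt_pi_div_two ((z.re + n) / |z.im|),
          Real.neg_pi_div_two_lt_arctan ((z.re + (0 : ℕ)) / |z.im|)]
    _ = Real.pi / |z.im| := (div_eq_inv_mul _ _).symm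

lemma sum_norm_gudermannTerm_le_re {z : ℂ} (hz : 0 < z.re) (n : ℕ) :
    ∑ k ∈ range n, ‖gudermannTerm (z + k)‖ ≤ 1 / z.re := by
  set F : ℕ → ℝ := fun k => (z.re + k)⁻¹ with hF
  have hterm : ∀ k ∈ range n, ‖gudermannTerm (z + k)‖ ≤ F k - F (k + 1) := fun k _ => by
    simpa [hF, add_assoc] using norm_gudermannTerm_le_inv (z := z + k)
      (by simp only [add_re, natCast_re]; positivity)
  calc ∑ k ∈ range n, ‖gudermannTerm (z + k)‖
      ≤ ∑ k ∈ range n, (F k - F (k + 1)) := sum_le_sum hterm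
    _ = z.re⁻¹ - (z.re + n)⁻¹ := by rw [sum_range_sub']; simp [hF]
    _ ≤ 1 / z.re := by rw [one_div]; exact sub_le_self _ (by positivity)

lemma summable_norm_gudermannTerm {z : ℂ} (hz : z ∈ slitPlane) :
    Summable fun k : ℕ => ‖gudermannTerm (z + k)‖ := by
  rcases mem_slitPlane_iff.1 hz with h | h
  · exact summable_of_sum_range_le (fun _ => norm_nonneg _) (sum_norm_gudermannTerm_le_re h)
  · exact summable_of_sum_range_le (fun _ => norm_nonneg _) (sum_norm_gudermannTerm_le_im h)

/-- Binet's function, the remainder in Stirling's formula for `log Γ`. -/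
noncomputable def binet (z : ℂ) : ℂ := ∑' k : ℕ, gudermannTerm (z + k)

lemma norm_binet_le_im {z : ℂ} (hz : z.im ≠ 0) : ‖binet z‖ ≤ Real.pi / |z.im| :=
  (norm_tsum_le_tsum_norm (summable_norm_gudermannTerm (mem_slitPlane_iff.2 (Or.inr hz)))).trans
    (Real.tsum_le_of_sum_range_le (fun _ => norm_nonneg _) (sum_norm_gudermannTerm_le_im hz))

lemma norm_binet_le_re {z : ℂ} (hz : 0 < z.re) : ‖binet z‖ ≤ 1 / z.re :=
  (norm_tsum_le_tsum_norm (summable_norm_gudermannTerm (mem_slitPlane_iff.2 (Or.inl hz)))).trans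
    (Real.tsum_le_of_sum_range_le (fun _ => norm_nonneg _) (sum_norm_gudermannTerm_le_re hz))

lemma prod_add_natCast_eq_exp {z : ℂ} (hz : z ∈ slitPlane) (n : ℕ) :
    ∏ k ∈ range n, (z + k) = exp (∑ k ∈ range n, log (z + k)) := by
  rw [exp_sum]
  exact prod_congr rfl fun k _ =>
    (exp_log (slitPlane_ne_zero (add_natCast_mem_slitPlane hz k))).symm

lemma sum_gudermannTerm (z : ℂ) (n : ℕ) :
    ∑ k ∈ range n, gudermannTerm (z + k) =
      (z + n - 1 / 2) * log (z + n) - n - (z - 1 / 2) * log z - ∑ k ∈ range n, log (z + k) := by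
  induction n with
  | zero => simp
  | succ n ih =>
    rw [sum_range_succ, sum_range_succ, ih, gudermannTerm]
    push_cast
    rw [← add_assoc]
    ring

lemma factorial_eq_stirlingSeq_mul_exp {n : ℕ} (hn : n ≠ 0) :
    (n.factorial : ℝ) =
      Stirling.stirlingSeq n * √2 * Real.exp ((n + 1 / 2) * Real.log n - n) := by
  have hnR : (0 : ℝ) < n := by positivity
  have hsqrt : √(n : ℝ) ≠ 0 := (Real.sqrt_pos.2 hnR).ne'
  have hexp : Real.exp ((n + 1 / 2) * Real.log n - n) = √n * (n / Real.exp 1) ^ n := by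
    rw [div_pow, ← Real.exp_nat_mul, mul_one, Real.exp_sub, add_mul, Real.exp_add,
      Real.exp_nat_mul, Real.exp_log hnR, Real.sqrt_eq_rpow, Real.rpow_def_of_pos hnR]
    ring_nf
  rw [hexp, Stirling.stirlingSeq, Real.sqrt_mul zero_le_two]
  field_simp

lemma GammaSeq_eq_stirlingSeq_mul_exp {z : ℂ} (hz : z ∈ slitPlane) {n : ℕ} (hn : n ≠ 0) :
    GammaSeq z n = (Stirling.stirlingSeq n * √2 : ℝ) *
      exp (1 - (z + n + 1 / 2) * (log (z + n + 1) - log n) +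
        ((z - 1 / 2) * log z + ∑ k ∈ range (n + 1), gudermannTerm (z + k))) := by
  have hfact : (n.factorial : ℂ) =
      (Stirling.stirlingSeq n * √2 : ℝ) * exp ((n + 1 / 2) * log n - n) := by
    rw [← ofReal_natCast, factorial_eq_stirlingSeq_mul_exp hn]
    push_cast
    simp
  rw [GammaSeq, hfact, cpow_def_of_ne_zero (Nat.cast_ne_zero.2 hn),
    prod_add_natCast_eq_exp hz, sum_gudermannTerm, div_eq_mul_inv, ← exp_neg, mul_left_comm,
    mul_assoc, ← exp_add, ← exp_add]
  congr 2
  push_cast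
  rw [← add_assoc z]
  ring

lemma tendsto_mul_log_sub_log (z : ℂ) :
    Tendsto (fun n : ℕ => (z + n + 1 / 2) * (log (z + n + 1) - log n)) atTop (𝓝 (z + 1)) := by
  have hinv : ∀ w : ℂ, Tendsto (fun n : ℕ => 1 + w * (n : ℂ)⁻¹) atTop (𝓝 1) := fun w => by
    simpa using ((tendsto_inv_atTop_nhds_zero_nat (𝕜 := ℂ)).const_mul w).const_add 1
  have hlog : Tendsto (fun n : ℕ => (n : ℂ) * log (1 + (z + 1) / n)) atTop (𝓝 (z + 1)) := by
    refine tendsto_nat_mul_log_one_add_of_tendsto (tendsto_const_nhds.congr' ?_)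
    filter_upwards [eventually_ne_atTop 0] with n hn
    have : (n : ℂ) ≠ 0 := Nat.cast_ne_zero.2 hn
    field_simp
  have hmul := (hinv (z + 1 / 2)).mul hlog
  rw [one_mul] at hmul
  refine hmul.congr' ?_
  filter_upwards [eventually_ne_atTop 0, (hinv (z + 1)).eventually_ne one_ne_zero] with n hn hne
  have hn0 : (n : ℂ) ≠ 0 := Nat.cast_ne_zero.2 hn
  have hnR : (0 : ℝ) < n := by positivity
  have hfactor : z + n + 1 = ((n : ℝ) : ℂ) * (1 + (z + 1) * (n : ℂ)⁻¹) := by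
    push_cast; field_simp; ring
  rw [hfactor, log_ofReal_mul hnR hne, ofReal_log hnR.le, ofReal_natCast]
  field_simp
  ring

theorem Gamma_eq_exp_binet {z : ℂ} (hz : z ∈ slitPlane) :
    Gamma z = (√(2 * Real.pi) : ℝ) * exp ((z - 1 / 2) * log z - z + binet z) := by
  have hstirling : Tendsto (fun n : ℕ => ((Stirling.stirlingSeq n * √2 : ℝ) : ℂ)) atTop
      (𝓝 ((√(2 * Real.pi) : ℝ) : ℂ)) := by
    rw [mul_comm 2, Real.sqrt_mul Real.pi_pos.le]
    exact (continuous_ofReal.tendsto _).comp (Stirling.tendsto_stirlingSeq_sqrt_pi.mul_const _)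
  have hbinet : Tendsto (fun n : ℕ => ∑ k ∈ range (n + 1), gudermannTerm (z + k)) atTop
      (𝓝 (binet z)) :=
    (summable_norm_gudermannTerm hz).of_norm.hasSum.tendsto_sum_nat.comp (tendsto_add_atTop_nat 1)
  have hexp := (continuous_exp.tendsto _).comp
    (((tendsto_mul_log_sub_log z).const_sub 1).add (hbinet.const_add ((z - 1 / 2) * log z)))
  have hlim := (hstirling.mul hexp).congr' (f₂ := GammaSeq z) (by
    filter_upwards [eventually_ne_atTop 0] with n hn
    exact (GammaSeq_eq_stirlingSeq_mul_exp hz hn).symm)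
  rw [tendsto_nhds_unique (GammaSeq_tendsto_Gamma z) hlim]
  congr 2
  ring

/-! ### Decay of the gamma ratio -/

lemma eventually_re_ge (R : ℝ) : ∀ᶠ s : ℂ in comap re atTop, R ≤ s.re :=
  tendsto_comap.eventually (eventually_ge_atTop R)

lemma isBigO_exp_sub_one {α : Type*} {l : Filter α} {E : α → ℂ}
    (hE : E =O[l] fun _ => (1 : ℝ)) : (fun x => exp (E x) - 1) =O[l] E := by
  obtain ⟨M, hM⟩ := hE.bound
  refine IsBigO.of_bound (Real.exp M) (hM.mono fun x hx => ?_)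
  rw [norm_one, mul_one] at hx
  calc ‖exp (E x) - 1‖ ≤ ‖E x‖ * Real.exp ‖E x‖ := by
        simpa using norm_exp_sub_sum_le_norm_mul_exp (E x) 1
    _ ≤ Real.exp M * ‖E x‖ := by rw [mul_comm]; gcongr

/-- `E s = O(1 / Im s)` uniformly off every strip about the real axis, and `E s = O(1 / Re s)` to
the far right; no bound is imposed near the negative real axis, where the poles of the gamma
functions accumulate. -/
def DecaysOffAxis (E : ℂ → ℂ) : Prop :=
  (∀ d : ℝ, 0 < d → E =O[𝓟 {s : ℂ | d ≤ |s.im|}] fun s => s.im⁻¹) ∧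
    E =O[comap re atTop] fun s => s.re⁻¹

namespace DecaysOffAxis

variable {E F : ℂ → ℂ}

lemma const_mul (hE : DecaysOffAxis E) (w : ℂ) : DecaysOffAxis fun s => w * E s :=
  ⟨fun d hd => (hE.1 d hd).const_mul_left w, hE.2.const_mul_left w⟩

lemma add (hE : DecaysOffAxis E) (hF : DecaysOffAxis F) : DecaysOffAxis fun s => E s + F s :=
  ⟨fun d hd => (hE.1 d hd).add (hF.1 d hd), hE.2.add hF.2⟩

lemma sub (hE : DecaysOffAxis E) (hF : DecaysOffAxis F) : DecaysOffAxis fun s => E s - F s :=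
  ⟨fun d hd => (hE.1 d hd).sub (hF.1 d hd), hE.2.sub hF.2⟩

lemma sum {ι : Type*} {S : Finset ι} {E : ι → ℂ → ℂ} (hE : ∀ i ∈ S, DecaysOffAxis (E i)) :
    DecaysOffAxis fun s => ∑ i ∈ S, E i s :=
  ⟨fun d hd => IsBigO.fun_sum fun i hi => (hE i hi).1 d hd, IsBigO.fun_sum fun i hi => (hE i hi).2⟩

lemma congr (hE : DecaysOffAxis E) (him : ∀ s : ℂ, s.im ≠ 0 → E s = F s)
    (hre : E =ᶠ[comap re atTop] F) : DecaysOffAxis F :=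
  ⟨fun d hd => (hE.1 d hd).congr' (eventually_principal.2 fun s hs =>
    him s (abs_pos.1 (hd.trans_le hs))) EventuallyEq.rfl, hE.2.congr' hre EventuallyEq.rfl⟩

lemma exp_sub_one (hE : DecaysOffAxis E) : DecaysOffAxis fun s => exp (E s) - 1 := by
  refine ⟨fun d hd => (isBigO_exp_sub_one ((hE.1 d hd).trans ?_)).trans (hE.1 d hd),
    (isBigO_exp_sub_one (hE.2.trans ?_)).trans hE.2⟩
  · refine IsBigO.of_bound d⁻¹ (eventually_principal.2 fun s hs => ?_)
    rw [norm_one, mul_one, norm_inv, Real.norm_eq_abs]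
    exact inv_anti₀ hd hs
  · refine IsBigO.of_bound 1 ((eventually_re_ge 1).mono fun s hs => ?_)
    rw [norm_one, mul_one, norm_inv, Real.norm_eq_abs, abs_of_nonneg (by linarith)]
    exact inv_le_one_of_one_le₀ hs

lemma of_norm_le {C α : ℝ}
    (h : ∀ (s : ℂ) (d : ℝ), 0 < d →
      (∀ t : ℝ, |t| ≤ |α| → s + t ∈ slitPlane ∧ d ≤ ‖s + t‖) → ‖E s‖ ≤ C / d) :
    DecaysOffAxis E := by
  refine ⟨fun d hd => IsBigO.of_bound C (eventually_principal.2 fun s hs => ?_),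
    IsBigO.of_bound (2 * C) ((eventually_re_ge (2 * |α| + 1)).mono fun s hs => ?_)⟩
  · have him : 0 < |s.im| := hd.trans_le hs
    rw [norm_inv, Real.norm_eq_abs, ← div_eq_mul_inv]
    refine h s _ him fun t _ => ⟨mem_slitPlane_iff.2 (Or.inr ?_), ?_⟩
    · simpa using abs_pos.1 him
    · simpa using abs_im_le_norm (s + t)
  · have hpos : 0 < s.re := by linarith [abs_nonneg α]
    rw [norm_inv, Real.norm_of_nonneg hpos.le, ← div_eq_mul_inv, mul_comm, ← div_div_eq_mul_div]
    refine h s _ (by positivity) fun t ht => ?_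
    have hre : s.re / 2 ≤ (s + t).re := by
      rw [add_re, ofReal_re]
      linarith [neg_abs_le t]
    exact ⟨mem_slitPlane_iff.2 (Or.inl ((by positivity : 0 < s.re / 2).trans_le hre)),
      hre.trans (re_le_norm _)⟩

lemma comp_affine (hE : DecaysOffAxis E) {A : ℝ} (hA : 0 < A) (a : ℝ) :
    DecaysOffAxis fun s => E (A * s + a) := by
  have him : ∀ s : ℂ, ((A : ℂ) * s + a).im = A * s.im := fun s => by simp
  have hre : ∀ s : ℂ, ((A : ℂ) * s + a).re = A * s.re + a := fun s => by simp
  refine ⟨fun d hd => ?_, ?_⟩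
  · have hmaps : Tendsto (fun s : ℂ => (A : ℂ) * s + a) (𝓟 {s | d ≤ |s.im|})
        (𝓟 {s | A * d ≤ |s.im|}) := tendsto_principal_principal.2 fun s hs => by
      rw [Set.mem_ofPred_eq, him, abs_mul, abs_of_pos hA]
      exact mul_le_mul_of_nonneg_left hs hA.le
    refine ((hE.1 _ (mul_pos hA hd)).comp_tendsto hmaps).trans ?_
    simp only [Function.comp_def, him, mul_inv]
    exact (isBigO_refl _ _).const_mul_left _
  · have hmaps : Tendsto (fun s : ℂ => (A : ℂ) * s + a) (comap re atTop) (comap re atTop) :=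
      tendsto_comap_iff.2 <| by
        simp only [Function.comp_def, hre]
        exact tendsto_atTop_add_const_right _ _ (tendsto_comap.const_mul_atTop hA)
    refine (hE.2.comp_tendsto hmaps).trans (IsBigO.of_bound (2 / A) ?_)
    filter_upwards [eventually_re_ge (2 * |a| / A + 1)] with s hs
    have hbound : A / 2 * s.re ≤ A * s.re + a := by
      have h := mul_le_mul_of_nonneg_left hs hA.le
      rw [mul_add, mul_div_cancel₀ _ hA.ne'] at h
      linarith [neg_abs_le a]
    have hpos : 0 < s.re := lt_of_lt_of_le (by positivity) hs
    have hprod : 0 < A / 2 * s.re := by positivity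
    rw [Function.comp_apply, hre, norm_inv, norm_inv, Real.norm_of_nonneg hpos.le,
      Real.norm_of_nonneg (hprod.le.trans hbound), ← inv_div, ← mul_inv]
    exact inv_anti₀ hprod hbound

end DecaysOffAxis

lemma decaysOffAxis_binet : DecaysOffAxis binet := by
  refine ⟨fun d hd => IsBigO.of_bound Real.pi (eventually_principal.2 fun s hs => ?_),
    IsBigO.of_bound 1 ((eventually_re_ge 1).mono fun s hs => ?_)⟩
  · rw [norm_inv, Real.norm_eq_abs, ← div_eq_mul_inv]
    exact norm_binet_le_im (abs_pos.1 (hd.trans_le hs))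
  · rw [norm_inv, Real.norm_of_nonneg (by linarith), ← div_eq_mul_inv]
    exact norm_binet_le_re (by linarith)

section LogShift

variable {s : ℂ} {α d : ℝ}

lemma norm_log_add_sub_log_le (hd : 0 < d)
    (h : ∀ t : ℝ, |t| ≤ |α| → s + t ∈ slitPlane ∧ d ≤ ‖s + t‖) :
    ‖log (s + α) - log s‖ ≤ |α| / d := by
  have hmem : ∀ t ∈ Set.uIcc 0 α, |t| ≤ |α| := fun t ht => by
    simpa using Set.abs_sub_left_of_mem_uIcc ht
  have hmvt := (convex_uIcc (0 : ℝ) α).norm_image_sub_le_of_norm_hasDerivWithin_le (C := 1 / d)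
    (fun t ht => (((hasDerivAt_ofReal t).const_add s).clog_real
      (h t (hmem t ht)).1).hasDerivWithinAt)
    (fun t ht => by
      rw [norm_div, norm_one]
      exact one_div_le_one_div_of_le hd (h t (hmem t ht)).2)
    Set.left_mem_uIcc Set.right_mem_uIcc
  simpa [div_eq_inv_mul] using hmvt

lemma norm_mul_log_add_sub_log_sub_le (hd : 0 < d)
    (h : ∀ t : ℝ, |t| ≤ |α| → s + t ∈ slitPlane ∧ d ≤ ‖s + t‖) :
    ‖s * (log (s + α) - log s) - α‖ ≤ α ^ 2 / d := by
  have hmem : ∀ t ∈ Set.uIcc 0 α, |t| ≤ |α| := fun t ht => by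
    simpa using Set.abs_sub_left_of_mem_uIcc ht
  have hmvt := (convex_uIcc (0 : ℝ) α).norm_image_sub_le_of_norm_hasDerivWithin_le (C := |α| / d)
    (f := fun t : ℝ => s * (log (s + t) - log s) - t)
    (f' := fun t : ℝ => s * (1 / (s + t)) - 1)
    (fun t ht => (((((hasDerivAt_ofReal t).const_add s).clog_real
      (h t (hmem t ht)).1).sub_const _ |>.const_mul s).sub (hasDerivAt_ofReal t)).hasDerivWithinAt)
    (fun t ht => by
      have hne : s + t ≠ 0 := slitPlane_ne_zero (h t (hmem t ht)).1
      have hderiv : s * (1 / (s + t)) - 1 = -t / (s + t) := by field_simp; ring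
      rw [hderiv, norm_div, norm_neg, norm_real, Real.norm_eq_abs]
      exact div_le_div₀ (abs_nonneg _) (hmem t ht) hd (h t (hmem t ht)).2)
    Set.left_mem_uIcc Set.right_mem_uIcc
  have hsq : |α| / d * |α| = α ^ 2 / d := by rw [div_mul_eq_mul_div, ← pow_two, sq_abs]
  simpa [hsq] using hmvt

lemma decaysOffAxis_log_add_sub_log (α : ℝ) :
    DecaysOffAxis fun s => log (s + α) - log s :=
  .of_norm_le fun _ _ => norm_log_add_sub_log_le

lemma decaysOffAxis_mul_log_add_sub_log_sub (α : ℝ) :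
    DecaysOffAxis fun s => s * (log (s + α) - log s) - α :=
  .of_norm_le fun _ _ => norm_mul_log_add_sub_log_sub_le

end LogShift

section GammaAffine

variable {A : ℝ}

lemma affine_eq_mul_add_div (hA : 0 < A) (a : ℝ) (s : ℂ) :
    (A : ℂ) * s + a = A * (s + (a / A : ℝ)) := by
  rw [mul_add, ← ofReal_mul, mul_div_cancel₀ _ hA.ne']

/-- The error term in Stirling's formula for `Γ(A s + a)`, see `Gamma_affine_eq_exp`. -/
noncomputable def gammaAffineRemainder (A a : ℝ) (s : ℂ) : ℂ :=
  binet (A * s + a) + (A * s + a - 1 / 2) * (log (s + (a / A : ℝ)) - log s) - a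

lemma decaysOffAxis_gammaAffineRemainder (hA : 0 < A) (a : ℝ) :
    DecaysOffAxis (gammaAffineRemainder A a) := by
  have hdecay := ((decaysOffAxis_binet.comp_affine hA a).add
    ((decaysOffAxis_mul_log_add_sub_log_sub (a / A)).const_mul A)).add
    ((decaysOffAxis_log_add_sub_log (a / A)).const_mul (a - 1 / 2 : ℝ))
  have heq : ∀ s, binet (A * s + a) + A * (s * (log (s + (a / A : ℝ)) - log s) - (a / A : ℝ)) +
      (a - 1 / 2 : ℝ) * (log (s + (a / A : ℝ)) - log s) = gammaAffineRemainder A a s := fun s => by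
    have hcancel : (A : ℂ) * (a / A : ℝ) = a := by rw [← ofReal_mul, mul_div_cancel₀ _ hA.ne']
    rw [gammaAffineRemainder]
    push_cast at hcancel ⊢
    linear_combination -hcancel
  exact hdecay.congr (fun s _ => heq s) (Eventually.of_forall heq)

lemma Gamma_affine_eq_exp (hA : 0 < A) (a : ℝ) {s : ℂ} (hs : s + (a / A : ℝ) ∈ slitPlane) :
    Gamma (A * s + a) = exp (s * (A * Real.log A : ℝ) + ((a - 1 / 2) * Real.log A : ℝ)
      + (s * A + (a - 1 / 2 : ℝ)) * log s - s * A + (Real.log (2 * Real.pi) / 2 : ℝ)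
      + gammaAffineRemainder A a s) := by
  have hlog : log ((A : ℂ) * s + a) = Real.log A + log (s + (a / A : ℝ)) := by
    rw [affine_eq_mul_add_div hA, log_ofReal_mul hA (slitPlane_ne_zero hs)]
  have hslit : (A : ℂ) * s + a ∈ slitPlane := by
    rw [affine_eq_mul_add_div hA, mem_slitPlane_iff, re_ofReal_mul, im_ofReal_mul]
    exact (mem_slitPlane_iff.1 hs).imp (mul_pos hA) (mul_ne_zero hA.ne')
  rw [Gamma_eq_exp_binet hslit, Real.sqrt_eq_rpow, Real.rpow_def_of_pos (by positivity),
    ofReal_exp, ← exp_add, hlog, gammaAffineRemainder]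
  congr 1
  push_cast
  ring

end GammaAffine

section GammaRatio

variable {p q : ℕ} {A a : Fin p → ℝ} {B b : Fin q → ℝ}

lemma rho_pos (hA : ∀ k, 0 < A k) (hB : ∀ j, 0 < B j) : 0 < rho A B :=
  mul_pos (prod_pos fun k _ => Real.rpow_pos_of_pos (hA k) _)
    (prod_pos fun j _ => Real.rpow_pos_of_pos (hB j) _)

lemma nu_pos (hA : ∀ k, 0 < A k) (hB : ∀ j, 0 < B j) (a : Fin p → ℝ) (b : Fin q → ℝ) :
    0 < nu A a B b :=
  mul_pos (mul_pos (Real.rpow_pos_of_pos Real.two_pi_pos _)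
    (prod_pos fun k _ => Real.rpow_pos_of_pos (hA k) _))
    (prod_pos fun j _ => Real.rpow_pos_of_pos (hB j) _)

lemma log_prod_rpow {n : ℕ} {x : Fin n → ℝ} (hx : ∀ i, 0 < x i) (y : Fin n → ℝ) :
    Real.log (∏ i, x i ^ y i) = ∑ i, y i * Real.log (x i) := by
  rw [Real.log_prod fun i _ => (Real.rpow_pos_of_pos (hx i) _).ne']
  exact sum_congr rfl fun i _ => Real.log_rpow (hx i) _

lemma prod_rpow_ne_zero {n : ℕ} {x : Fin n → ℝ} (hx : ∀ i, 0 < x i) (y : Fin n → ℝ) :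
    ∏ i, x i ^ y i ≠ 0 :=
  prod_ne_zero_iff.2 fun i _ => (Real.rpow_pos_of_pos (hx i) _).ne'

lemma log_rho (hA : ∀ k, 0 < A k) (hB : ∀ j, 0 < B j) :
    Real.log (rho A B) = ∑ k, A k * Real.log (A k) - ∑ j, B j * Real.log (B j) := by
  rw [rho, Real.log_mul (prod_rpow_ne_zero hA _) (prod_rpow_ne_zero hB _), log_prod_rpow hA,
    log_prod_rpow hB]
  simp only [neg_mul, sum_neg_distrib, sub_eq_add_neg]

lemma log_nu (hA : ∀ k, 0 < A k) (hB : ∀ j, 0 < B j) (a : Fin p → ℝ) (b : Fin q → ℝ) :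
    Real.log (nu A a B b) = ((p : ℝ) - q) / 2 * Real.log (2 * Real.pi) +
      ∑ k, (a k - 1 / 2) * Real.log (A k) - ∑ j, (b j - 1 / 2) * Real.log (B j) := by
  have hpi : (2 * Real.pi) ^ (((p : ℝ) - q) / 2) ≠ 0 :=
    (Real.rpow_pos_of_pos Real.two_pi_pos _).ne'
  have hneg : ∑ j, (1 / 2 - b j) * Real.log (B j) = -∑ j, (b j - 1 / 2) * Real.log (B j) := by
    simp only [← sum_neg_distrib, ← neg_mul, neg_sub]
  rw [nu, Real.log_mul (mul_ne_zero hpi (prod_rpow_ne_zero hA _)) (prod_rpow_ne_zero hB _),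
    Real.log_mul hpi (prod_rpow_ne_zero hA _), Real.log_rpow Real.two_pi_pos,
    log_prod_rpow hA, log_prod_rpow hB, hneg, ← sub_eq_add_neg]

/-- The gamma ratio divided by the exponential factor `ρ ^ s` of its asymptotics; it tends to `ν`
far from the negative real axis when `μ = 0`. -/
noncomputable def normRatio (A a : Fin p → ℝ) (B b : Fin q → ℝ) (s : ℂ) : ℂ :=
  gammaRatioC A a B b s * exp (-(s * Real.log (rho A B)))

lemma prod_Gamma_affine_eq_exp (hA : ∀ k, 0 < A k) {s : ℂ}
    (hs : ∀ k, s + (a k / A k : ℝ) ∈ slitPlane) :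
    ∏ k, Gamma (A k * s + a k) = exp (s * (∑ k, A k * Real.log (A k) : ℝ)
      + (∑ k, (a k - 1 / 2) * Real.log (A k) : ℝ)
      + (s * (∑ k, A k : ℝ) + (∑ k, a k - p / 2 : ℝ)) * log s - s * (∑ k, A k : ℝ)
      + (p * (Real.log (2 * Real.pi) / 2) : ℝ) + ∑ k, gammaAffineRemainder (A k) (a k) s) := by
  rw [prod_congr rfl fun k _ => Gamma_affine_eq_exp (hA k) (a k) (hs k), ← exp_sum]
  congr 1
  simp only [sum_add_distrib, sum_sub_distrib, ← mul_sum, ← sum_mul, ← ofReal_sum, sum_const,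
    card_univ, Fintype.card_fin, nsmul_eq_mul]
  push_cast
  ring

lemma normRatio_eq_mul_exp (hA : ∀ k, 0 < A k) (hB : ∀ j, 0 < B j)
    (hΔ : ∑ j, B j = ∑ k, A k) (hμ : mu a b = 0) {s : ℂ}
    (hsA : ∀ k, s + (a k / A k : ℝ) ∈ slitPlane) (hsB : ∀ j, s + (b j / B j : ℝ) ∈ slitPlane) :
    normRatio A a B b s = nu A a B b * exp (∑ k, gammaAffineRemainder (A k) (a k) s -
      ∑ j, gammaAffineRemainder (B j) (b j) s) := by
  have hν : (nu A a B b : ℂ) = exp (Real.log (nu A a B b)) := by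
    rw [← ofReal_exp, Real.exp_log (nu_pos hA hB a b)]
  have hsum : ∑ k, a k = ∑ j, b j + ((p : ℝ) - q) / 2 := by rw [mu] at hμ; linarith
  rw [normRatio, gammaRatioC, prod_Gamma_affine_eq_exp hA hsA, prod_Gamma_affine_eq_exp hB hsB,
    hν, log_nu hA hB, log_rho hA hB, ← exp_sub, ← exp_add, ← exp_add, hΔ, hsum]
  congr 1
  push_cast
  ring

lemma decaysOffAxis_normRatio_sub_nu (hA : ∀ k, 0 < A k) (hB : ∀ j, 0 < B j)
    (hΔ : ∑ j, B j = ∑ k, A k) (hμ : mu a b = 0) :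
    DecaysOffAxis fun s => normRatio A a B b s - nu A a B b := by
  have hdecay := ((DecaysOffAxis.sum fun k (_ : k ∈ univ) =>
    decaysOffAxis_gammaAffineRemainder (hA k) (a k)).sub (.sum fun j (_ : j ∈ univ) =>
    decaysOffAxis_gammaAffineRemainder (hB j) (b j))).exp_sub_one.const_mul (nu A a B b : ℂ)
  have hstirling : ∀ s : ℂ, (∀ k, s + (a k / A k : ℝ) ∈ slitPlane) →
      (∀ j, s + (b j / B j : ℝ) ∈ slitPlane) → nu A a B b *
        (exp (∑ k, gammaAffineRemainder (A k) (a k) s - ∑ j, gammaAffineRemainder (B j) (b j) s)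
          - 1) = normRatio A a B b s - nu A a B b := fun s hsA hsB => by
    rw [normRatio_eq_mul_exp hA hB hΔ hμ hsA hsB, mul_sub, mul_one]
  have hoff : ∀ (x : ℝ) (s : ℂ), s.im ≠ 0 → s + x ∈ slitPlane := fun x s hs =>
    mem_slitPlane_iff.2 (Or.inr (by simpa using hs))
  have hright : ∀ x : ℝ, ∀ᶠ s : ℂ in comap re atTop, s + x ∈ slitPlane := fun x =>
    (eventually_re_ge (|x| + 1)).mono fun s hs => mem_slitPlane_iff.2 (Or.inl (by
      rw [add_re, ofReal_re]; linarith [neg_abs_le x]))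
  refine hdecay.congr (fun s hs => hstirling s (fun _ => hoff _ s hs) fun _ => hoff _ s hs) ?_
  filter_upwards [eventually_all.2 fun k => hright (a k / A k),
    eventually_all.2 fun j => hright (b j / B j)] with s hsA hsB using hstirling s hsA hsB

end GammaRatio

/-! ### Cauchy's theorem on half-strips and half-planes -/

lemma continuousOn_horizontal {f : ℂ → ℂ} {c y : ℝ}
    (hf : ∀ u : ℝ, u ≤ c → ContinuousAt f (u + y * I)) :
    ContinuousOn (fun u : ℝ => f (u + y * I)) (Set.Iic c) := fun u hu =>
  (ContinuousAt.comp (f := fun u : ℝ => (u : ℂ) + y * I) (hf u hu)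
    (by fun_prop)).continuousWithinAt

lemma continuous_vertical {f : ℂ → ℂ} {c : ℝ} (hf : ∀ v : ℝ, ContinuousAt f (c + v * I)) :
    Continuous fun v : ℝ => f (c + v * I) :=
  continuous_iff_continuousAt.2 fun v =>
    ContinuousAt.comp (f := fun v : ℝ => (c : ℂ) + v * I) (hf v) (by fun_prop)

section HorizontalRay

variable {f : ℂ → ℂ} {c y M l : ℝ}

lemma integrableOn_horizontal (hl : 0 < l)
    (hf : ∀ u : ℝ, u ≤ c → ContinuousAt f (u + y * I))
    (hM : ∀ u : ℝ, u ≤ c → ‖f (u + y * I)‖ ≤ M * Real.exp (l * u)) :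
    IntegrableOn (fun u : ℝ => f (u + y * I)) (Set.Iic c) :=
  Integrable.mono' ((integrableOn_exp_mul_Iic hl c).const_mul M)
    ((continuousOn_horizontal hf).aestronglyMeasurable measurableSet_Iic)
    ((ae_restrict_iff' measurableSet_Iic).2 (Eventually.of_forall hM))

lemma norm_integral_horizontal_le (hl : 0 < l)
    (hM : ∀ u : ℝ, u ≤ c → ‖f (u + y * I)‖ ≤ M * Real.exp (l * u)) :
    ‖∫ u in Set.Iic c, f ((u : ℂ) + y * I)‖ ≤ M * (Real.exp (l * c) / l) := by
  rw [← integral_exp_mul_Iic hl, ← integral_const_mul]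
  exact norm_integral_le_of_norm_le ((integrableOn_exp_mul_Iic hl c).const_mul M)
    ((ae_restrict_iff' measurableSet_Iic).2 (Eventually.of_forall hM))

end HorizontalRay

lemma integral_boundary_rect_eq_zero {f : ℂ → ℂ} {x₁ x₂ y₁ y₂ : ℝ} (hx : x₁ ≤ x₂) (hy : y₁ ≤ y₂)
    (hf : ∀ s ∈ Set.Icc x₁ x₂ ×ℂ Set.Icc y₁ y₂, DifferentiableAt ℂ f s) :
    (∫ x in x₁..x₂, f (x + y₁ * I)) - (∫ x in x₁..x₂, f (x + y₂ * I)) +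
      I * (∫ y in y₁..y₂, f (x₂ + y * I)) - I * ∫ y in y₁..y₂, f (x₁ + y * I) = 0 := by
  have h := integral_boundary_rect_eq_zero_of_differentiableOn f (x₁ + y₁ * I) (x₂ + y₂ * I)
  simp only [add_re, ofReal_re, mul_re, I_re, mul_zero, ofReal_im, I_im, mul_one, sub_self,
    add_zero, add_im, mul_im, zero_add, smul_eq_mul, Set.uIcc_of_le hx, Set.uIcc_of_le hy] at h
  exact h fun s hs => (hf s hs).differentiableWithinAt

section LeftHalfStrip

variable {f : ℂ → ℂ} {c y₁ y₂ M l : ℝ}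

lemma tendsto_integral_vertical_atBot (hl : 0 < l) (hy : y₁ ≤ y₂)
    (hM : ∀ s ∈ Set.Iic c ×ℂ Set.Icc y₁ y₂, ‖f s‖ ≤ M * Real.exp (l * s.re)) :
    Tendsto (fun x : ℝ => ∫ y in y₁..y₂, f (x + y * I)) atBot (𝓝 0) := by
  have hbound : Tendsto (fun x : ℝ => M * Real.exp (l * x) * |y₂ - y₁|) atBot (𝓝 0) := by
    simpa using ((Real.tendsto_exp_atBot.comp
      (tendsto_id.const_mul_atBot hl)).const_mul M).mul_const |y₂ - y₁|
  refine squeeze_zero_norm' ((eventually_le_atBot c).mono fun x hx => ?_) hbound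
  refine intervalIntegral.norm_integral_le_of_norm_le_const fun y hy' => ?_
  rw [Set.uIoc_of_le hy] at hy'
  simpa using hM (x + y * I) (by simpa [mem_reProdIm] using ⟨hx, hy'.1.le, hy'.2⟩)

lemma leftLoopIntegral_eq_zero (hl : 0 < l) (hy : y₁ ≤ y₂)
    (hf : ∀ s ∈ Set.Iic c ×ℂ Set.Icc y₁ y₂, DifferentiableAt ℂ f s)
    (hM : ∀ s ∈ Set.Iic c ×ℂ Set.Icc y₁ y₂, ‖f s‖ ≤ M * Real.exp (l * s.re)) :
    leftLoopIntegral c y₁ y₂ f = 0 := by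
  have hray : ∀ y ∈ Set.Icc y₁ y₂, Tendsto (fun x : ℝ => ∫ u in x..c, f (u + y * I)) atBot
      (𝓝 (∫ u in Set.Iic c, f ((u : ℂ) + y * I))) := fun y hy' => by
    have hmem : ∀ u : ℝ, u ≤ c → (u + y * I : ℂ) ∈ Set.Iic c ×ℂ Set.Icc y₁ y₂ := fun u hu => by
      simpa [mem_reProdIm] using ⟨hu, hy'⟩
    exact intervalIntegral_tendsto_integral_Iic c
      (integrableOn_horizontal hl (fun u hu => (hf _ (hmem u hu)).continuousAt)
        fun u hu => by simpa using hM _ (hmem u hu)) tendsto_id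
  have hlim := (((hray y₁ (Set.left_mem_Icc.2 hy)).sub (hray y₂ (Set.right_mem_Icc.2 hy))).add_const
    (I * ∫ y in y₁..y₂, f (c + y * I))).sub
    ((tendsto_integral_vertical_atBot hl hy hM).const_mul I)
  have hzero := hlim.congr' <| (eventually_le_atBot c).mono fun x hx =>
    integral_boundary_rect_eq_zero hx hy fun s hs => hf s ⟨hs.1.2, hs.2⟩
  have h := tendsto_nhds_unique hzero tendsto_const_nhds
  rw [leftLoopIntegral, intervalIntegral.integral_mul_const]
  linear_combination h

end LeftHalfStrip

lemma leftLoopIntegral_add_adjacent {f : ℂ → ℂ} {c y₁ y₂ y₃ : ℝ}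
    (hf : Continuous fun v : ℝ => f (c + v * I)) :
    leftLoopIntegral c y₁ y₂ f + leftLoopIntegral c y₂ y₃ f = leftLoopIntegral c y₁ y₃ f := by
  have hc : Continuous fun v : ℝ => f (c + v * I) * I := hf.mul continuous_const
  rw [leftLoopIntegral, leftLoopIntegral, leftLoopIntegral,
    ← intervalIntegral.integral_add_adjacent_intervals (hc.intervalIntegrable y₁ y₂)
      (hc.intervalIntegrable y₂ y₃)]
  ring

section RightHalfPlane

variable {c : ℝ}

lemma norm_integral_vertical_le {Q : ℂ → ℂ} {B T : ℝ} (hcT : |c| ≤ T)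
    (hQ : ∀ s : ℂ, c ≤ s.re → DifferentiableAt ℂ Q s)
    (hB : ∀ s : ℂ, c ≤ s.re → T ≤ ‖s‖ → ‖Q s‖ ≤ B) :
    ‖∫ v in -T..T, Q (c + v * I)‖ ≤ 6 * B * T := by
  obtain ⟨hc, hc'⟩ := abs_le.1 hcT
  have hT : 0 ≤ T := (abs_nonneg c).trans hcT
  have hB0 : 0 ≤ B := (norm_nonneg _).trans (hB T (by simpa) (by simpa using le_abs_self T))
  have hside : ∀ y : ℝ, |y| = T → ‖∫ x in c..T, Q (x + y * I)‖ ≤ B * (2 * T) := fun y hy => by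
    refine (intervalIntegral.norm_integral_le_of_norm_le_const fun x hx => ?_).trans
      (mul_le_mul_of_nonneg_left (by rw [abs_of_nonneg] <;> linarith : |T - c| ≤ 2 * T) hB0)
    rw [Set.uIoc_of_le hc'] at hx
    exact hB _ (by simpa using hx.1.le) (by simpa [hy] using abs_im_le_norm (x + y * I : ℂ))
  have hright : ‖∫ y in -T..T, Q (T + y * I)‖ ≤ B * (2 * T) := by
    refine (intervalIntegral.norm_integral_le_of_norm_le_const fun y _ => ?_).trans
      (mul_le_mul_of_nonneg_left (by rw [abs_of_nonneg] <;> linarith : |T - -T| ≤ 2 * T) hB0)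
    exact hB _ (by simpa) (by simpa using re_le_norm (T + y * I : ℂ))
  have hcauchy := integral_boundary_rect_eq_zero hc' (neg_le_self hT) fun s hs => hQ s hs.1.1
  calc ‖∫ v in -T..T, Q (c + v * I)‖
      = ‖(∫ x in c..T, Q (x + (-T : ℝ) * I)) - (∫ x in c..T, Q (x + T * I)) +
          I * ∫ y in -T..T, Q (T + y * I)‖ := by
        rw [sub_eq_zero.1 hcauchy, norm_mul, norm_I, one_mul]
    _ ≤ B * (2 * T) + B * (2 * T) + B * (2 * T) := by
        refine norm_add_le_of_le (norm_sub_le_of_le (hside _ ?_) (hside _ ?_)) ?_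
        · rw [abs_neg, abs_of_nonneg hT]
        · exact abs_of_nonneg hT
        · rwa [norm_mul, norm_I, one_mul]
    _ = 6 * B * T := by ring

lemma tendsto_integral_vertical_zero {Q : ℂ → ℂ}
    (hQ : ∀ s : ℂ, c ≤ s.re → DifferentiableAt ℂ Q s)
    (hO : Q =O[cobounded ℂ ⊓ 𝓟 {s | c ≤ s.re}] fun s => ‖s‖⁻¹ ^ 2) :
    Tendsto (fun T : ℝ => ∫ v in -T..T, Q (c + v * I)) atTop (𝓝 0) := by
  obtain ⟨M, hM0, hM⟩ := hO.exists_pos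
  rw [IsBigOWith, eventually_inf_principal, ← comap_norm_atTop] at hM
  obtain ⟨R, -, hR⟩ := (atTop_basis.comap _).eventually_iff.1 hM
  have hlim : Tendsto (fun T : ℝ => 6 * M * T⁻¹) atTop (𝓝 0) := by
    simpa using tendsto_inv_atTop_zero.const_mul (6 * M)
  refine squeeze_zero_norm' ?_ hlim
  filter_upwards [eventually_ge_atTop R, eventually_ge_atTop |c|, eventually_gt_atTop 0]
    with T hRT hcT hT
  have hB : ∀ s : ℂ, c ≤ s.re → T ≤ ‖s‖ → ‖Q s‖ ≤ M * T⁻¹ ^ 2 := fun s hs hsT => by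
    refine (hR (hRT.trans hsT) hs).trans ?_
    rw [norm_pow, norm_inv, norm_norm]
    gcongr
  calc ‖∫ v in -T..T, Q (c + v * I)‖ ≤ 6 * (M * T⁻¹ ^ 2) * T := norm_integral_vertical_le hcT hQ hB
    _ = 6 * M * T⁻¹ := by field_simp

lemma isBigO_inv_sub (y : ℂ) : (fun s : ℂ => (y - s)⁻¹) =O[cobounded ℂ] fun s => ‖s‖⁻¹ := by
  refine IsBigO.of_bound 2 ?_
  filter_upwards [eventually_cobounded_le_norm (2 * ‖y‖ + 1)] with s hs
  have hpos : 0 < ‖s‖ := by linarith [norm_nonneg y]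
  rw [norm_inv, norm_inv, norm_norm, ← div_eq_mul_inv, ← inv_div]
  refine inv_anti₀ (by positivity) ?_
  rw [norm_sub_rev]
  linarith [norm_sub_norm_le s y]

lemma isBigO_dslope {G : ℂ → ℂ} {l : Filter ℂ} (hl : l ≤ cobounded ℂ)
    (hG : G =O[l] fun _ => (1 : ℝ)) (x : ℂ) : dslope G x =O[l] fun s => ‖s‖⁻¹ := by
  have hne : ∀ᶠ s in l, s ≠ x := hl <| by
    filter_upwards [eventually_cobounded_le_norm (‖x‖ + 1)] with s hs
    rintro rfl
    linarith
  have h := ((isBigO_const_const (G x) one_ne_zero l).sub hG).mul ((isBigO_inv_sub x).mono hl)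
  simp only [one_mul] at h
  refine h.congr' (hne.mono fun s hs => ?_) EventuallyEq.rfl
  beta_reduce
  rw [dslope_of_ne _ hs, slope_def_field, ← div_eq_mul_inv, ← neg_sub s, ← neg_sub (G s),
    neg_div_neg_eq]

lemma differentiableAt_dslope {G : ℂ → ℂ} (hG : ∀ s : ℂ, c ≤ s.re → DifferentiableAt ℂ G s)
    {x : ℂ} (hx : c < x.re) {s : ℂ} (hs : c ≤ s.re) : DifferentiableAt ℂ (dslope G x) s := by
  rcases eq_or_ne s x with rfl | hsx
  · have hU : {s : ℂ | c < s.re} ∈ 𝓝 s := (isOpen_lt continuous_const continuous_re).mem_nhds hx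
    exact ((differentiableOn_dslope hU).2 fun s hs =>
      (hG s (le_of_lt hs)).differentiableWithinAt).differentiableAt hU
  · exact (differentiableAt_dslope_of_ne hsx).2 (hG s hs)

lemma continuous_poisson {d : ℝ} (hd : 0 < d) :
    Continuous fun v : ℝ => 2 * d / (d ^ 2 + v ^ 2) := by
  have hne : ∀ v : ℝ, d ^ 2 + v ^ 2 ≠ 0 := fun v => by positivity
  fun_prop (disch := exact hne _)

lemma integral_poisson {d : ℝ} (hd : 0 < d) (T : ℝ) :
    ∫ v in -T..T, 2 * d / (d ^ 2 + v ^ 2) = 4 * Real.arctan (T / d) := by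
  have hderiv : ∀ v : ℝ,
      HasDerivAt (fun v : ℝ => 2 * Real.arctan (v / d)) (2 * d / (d ^ 2 + v ^ 2)) v := fun v => by
    refine ((((hasDerivAt_id v).div_const d).arctan).const_mul 2).congr_deriv ?_
    have : 1 + (v / d) ^ 2 ≠ 0 := by positivity
    simp only [id]
    field_simp
  rw [intervalIntegral.integral_eq_sub_of_hasDerivAt (fun v _ => hderiv v)
    ((continuous_poisson hd).intervalIntegrable _ _), neg_div, Real.arctan_neg]
  ring

lemma tendsto_integral_poisson {d : ℝ} (hd : 0 < d) :
    Tendsto (fun T : ℝ => ∫ v in -T..T, 2 * d / (d ^ 2 + v ^ 2)) atTop (𝓝 (2 * Real.pi)) := by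
  simp_rw [integral_poisson hd]
  have h := ((Real.tendsto_arctan_atTop.mono_right nhdsWithin_le_nhds).comp
    (tendsto_id.atTop_div_const hd)).const_mul 4
  rwa [show 4 * (Real.pi / 2) = 2 * Real.pi by ring] at h

lemma ofReal_ne_vertical {x : ℝ} (hx : x ≠ c) (v : ℝ) : (x : ℂ) ≠ c + v * I := fun h =>
  hx (by simpa using congrArg re h)

/-- Subtracting the Cauchy kernel of the mirror image `2 c - x` of `x` in the line `Re s = c` turns
the Cauchy kernel of `x` into the Poisson kernel. -/
lemma div_sub_vertical_eq (G : ℂ → ℂ) {x : ℝ} (hx : x ≠ c) (v : ℝ) :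
    G (c + v * I) / (x - (c + v * I)) =
      G (c + v * I) * ((2 * c - x : ℝ) - (c + v * I))⁻¹ +
        dslope G x (c + v * I) * ((2 * c - x : ℝ) - (c + v * I))⁻¹ * (2 * (x - c)) +
        G x * (2 * (x - c) / ((x - c) ^ 2 + v ^ 2) : ℝ) := by
  set s : ℂ := c + v * I with hs
  have hxs : (x : ℂ) - s ≠ 0 := sub_ne_zero.2 (ofReal_ne_vertical hx v)
  have hys : ((2 * c - x : ℝ) : ℂ) - s ≠ 0 :=
    sub_ne_zero.2 (ofReal_ne_vertical (fun h => hx (by linarith)) v)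
  have hden : ((x - c) ^ 2 + v ^ 2 : ℂ) = -((x - s) * ((2 * c - x : ℝ) - s)) := by
    rw [hs]
    push_cast
    linear_combination (v : ℂ) ^ 2 * I_sq
  have hnum : (2 * (x - c) : ℂ) = (x - s) - ((2 * c - x : ℝ) - s) := by
    push_cast
    ring
  rw [dslope_of_ne _ (sub_ne_zero.1 hxs).symm, slope_def_field, ← neg_sub (x : ℂ) s]
  push_cast at hys hden hnum ⊢
  rw [hden, hnum]
  generalize (x : ℂ) - s = X at *
  generalize 2 * (c : ℂ) - x - s = Y at *
  field_simp
  ring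

lemma differentiableAt_inv_sub {y : ℝ} (hy : y < c) {s : ℂ} (hs : c ≤ s.re) :
    DifferentiableAt ℂ (fun s : ℂ => ((y : ℂ) - s)⁻¹) s := by
  refine DifferentiableAt.inv (by fun_prop) fun h => ?_
  have hre := congrArg re h
  rw [sub_re, ofReal_re, zero_re] at hre
  linarith

lemma continuous_vertical_mul_inv_sub {F : ℂ → ℂ} {y : ℝ}
    (hF : ∀ s : ℂ, c ≤ s.re → DifferentiableAt ℂ F s) (hy : y < c) :
    Continuous fun v : ℝ => F (c + v * I) * ((y : ℂ) - (c + v * I))⁻¹ :=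
  continuous_vertical (f := fun s => F s * ((y : ℂ) - s)⁻¹) fun _ =>
    ((hF _ (by simp)).mul (differentiableAt_inv_sub hy (by simp))).continuousAt

lemma tendsto_integral_mul_inv_sub_zero {F : ℂ → ℂ} {y : ℝ}
    (hF : ∀ s : ℂ, c ≤ s.re → DifferentiableAt ℂ F s)
    (hO : F =O[cobounded ℂ ⊓ 𝓟 {s | c ≤ s.re}] fun s => ‖s‖⁻¹) (hy : y < c) :
    Tendsto (fun T : ℝ => ∫ v in -T..T, F (c + v * I) * ((y : ℂ) - (c + v * I))⁻¹) atTop (𝓝 0) :=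
  tendsto_integral_vertical_zero (Q := fun s => F s * ((y : ℂ) - s)⁻¹)
    (fun s hs => (hF s hs).mul (differentiableAt_inv_sub hy hs))
    ((hO.mul ((isBigO_inv_sub y).mono inf_le_left)).congr_right fun _ => (pow_two _).symm)

lemma tendsto_integral_cauchy_halfPlane {G : ℂ → ℂ} {x : ℝ}
    (hG : ∀ s : ℂ, c ≤ s.re → DifferentiableAt ℂ G s)
    (hO : G =O[cobounded ℂ ⊓ 𝓟 {s | c ≤ s.re}] fun s => ‖s‖⁻¹) (hx : c < x) :
    Tendsto (fun T : ℝ => ∫ v in -T..T, G (c + v * I) / (x - (c + v * I))) atTop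
      (𝓝 (2 * Real.pi * G x)) := by
  have hy : 2 * c - x < c := by linarith
  have hG1 : G =O[cobounded ℂ ⊓ 𝓟 {s | c ≤ s.re}] fun _ => (1 : ℝ) :=
    hO.trans ((tendsto_inv_atTop_zero.comp
      (tendsto_norm_cobounded_atTop.mono_left inf_le_left)).isBigO_one ℝ)
  have hQ : ∀ s : ℂ, c ≤ s.re → DifferentiableAt ℂ (dslope G x) s := fun s hs =>
    differentiableAt_dslope hG (by simpa) hs
  have hP := (continuous_ofReal.tendsto _).comp (tendsto_integral_poisson (sub_pos.2 hx))
  have hlim := ((tendsto_integral_mul_inv_sub_zero hG hO hy).add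
    ((tendsto_integral_mul_inv_sub_zero hQ (isBigO_dslope inf_le_left hG1 x) hy).mul_const
      (2 * (x - c) : ℂ))).add (hP.const_mul (G x))
  rw [zero_mul, zero_add, zero_add, mul_comm (G x), ofReal_mul, ofReal_ofNat] at hlim
  refine hlim.congr fun T => ?_
  have hGc := continuous_vertical_mul_inv_sub hG hy
  have hQc := (continuous_vertical_mul_inv_sub hQ hy).mul_const (2 * (x - c) : ℂ)
  have hPc : Continuous fun v : ℝ => G x * (2 * (x - c) / ((x - c) ^ 2 + v ^ 2) : ℝ) :=
    (continuous_ofReal.comp (continuous_poisson (sub_pos.2 hx))).const_mul (G x)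
  rw [Function.comp_apply, ← intervalIntegral.integral_ofReal,
    ← intervalIntegral.integral_const_mul, ← intervalIntegral.integral_mul_const,
    ← intervalIntegral.integral_add (hGc.intervalIntegrable _ _) (hQc.intervalIntegrable _ _),
    ← intervalIntegral.integral_add ((hGc.fun_add hQc).intervalIntegrable _ _)
      (hPc.intervalIntegrable _ _)]
  exact intervalIntegral.integral_congr fun v _ => (div_sub_vertical_eq G hx.ne' v).symm

end RightHalfPlane

lemma DecaysOffAxis.isBigO_halfPlane {E : ℂ → ℂ} (hE : DecaysOffAxis E) (c : ℝ) :
    E =O[cobounded ℂ ⊓ 𝓟 {s | c ≤ s.re}] fun s => ‖s‖⁻¹ := by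
  obtain ⟨C, hC0, hC⟩ := (hE.1 1 one_pos).exists_pos
  obtain ⟨D, hD0, hD⟩ := hE.2.exists_pos
  rw [IsBigOWith, eventually_principal] at hC
  obtain ⟨R, -, hR⟩ := (atTop_basis.comap _).eventually_iff.1 hD.bound
  refine IsBigO.of_bound (2 * C + 2 * D) (eventually_inf_principal.2 ?_)
  filter_upwards [eventually_cobounded_le_norm (2 * (|c| + |R| + 1))] with s hs hcs
  have hpos : 0 < ‖s‖ := by linarith [abs_nonneg c, abs_nonneg R]
  have hcompare : ∀ t K : ℝ, 0 < K → ‖s‖ / 2 ≤ |t| → ‖E s‖ ≤ K * ‖t⁻¹‖ →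
      ‖E s‖ ≤ 2 * K * ‖(‖s‖⁻¹ : ℝ)‖ := fun t K hK ht h => by
    rw [norm_inv, norm_norm]
    calc ‖E s‖ ≤ K * (‖s‖ / 2)⁻¹ := h.trans (by rw [norm_inv, Real.norm_eq_abs]; gcongr)
      _ = 2 * K * ‖s‖⁻¹ := by rw [inv_div]; ring
  rcases le_total (‖s‖ / 2) |s.im| with him | him
  · have h1 : (1 : ℝ) ≤ |s.im| := by linarith [abs_nonneg c, abs_nonneg R]
    exact (hcompare _ C hC0 him (hC s h1)).trans (by gcongr; linarith)
  · have hre : ‖s‖ / 2 ≤ |s.re| := by linarith [norm_le_abs_re_add_abs_im s]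
    have hre0 : 0 ≤ s.re := by
      by_contra! h
      rw [abs_of_neg h] at hre
      have : c ≤ s.re := hcs
      linarith [neg_abs_le c, abs_nonneg R]
    have hRs : R ≤ s.re := by
      rw [abs_of_nonneg hre0] at hre
      linarith [le_abs_self R, abs_nonneg c]
    exact (hcompare _ D hD0 hre (hR hRs)).trans (by gcongr; linarith)

/-! ### Inverse Laplace transforms along loops -/

/-- `f` is complex differentiable at every point outside the real half-line `(-∞, c)`, which
contains the poles of the gamma ratio when `-aₖ / Aₖ < c` for all `k`. -/
def HolomorphicOffRay (c : ℝ) (f : ℂ → ℂ) : Prop :=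
  ∀ s : ℂ, s.im ≠ 0 ∨ c ≤ s.re → DifferentiableAt ℂ f s

/-- The inverse Laplace transform of `G + ν` at `l`, along a left loop. -/
noncomputable def loopTransform (c φ₁ φ₂ : ℝ) (G : ℂ → ℂ) (ν : ℂ) (l : ℝ) : ℂ :=
  (2 * (Real.pi : ℂ) * I)⁻¹ * leftLoopIntegral c φ₁ φ₂ fun s => (G s + ν) * exp (l * s)

/-- The inverse Laplace transform of `G` at `l`, along the vertical segment `[c - T i, c + T i]`. -/
noncomputable def verticalTransform (c : ℝ) (G : ℂ → ℂ) (T l : ℝ) : ℂ :=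
  (2 * (Real.pi : ℂ))⁻¹ * ∫ v in -T..T, G (c + v * I) * exp (l * (c + v * I))

lemma norm_exp_ofReal_mul (l : ℝ) (s : ℂ) : ‖exp (l * s)‖ = Real.exp (l * s.re) := by
  rw [norm_exp, re_ofReal_mul]

lemma norm_exp_ofReal_mul_vertical (l c v : ℝ) :
    ‖exp (l * (c + v * I))‖ = Real.exp (l * c) := by
  simp [norm_exp_ofReal_mul]

section Loop

variable {c d l : ℝ} {f g : ℂ → ℂ} {M N : ℝ}

lemma HolomorphicOffRay.continuous_vertical (hf : HolomorphicOffRay c f) :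
    Continuous fun v : ℝ => f (c + v * I) :=
  FoxH.continuous_vertical fun v => (hf _ (by simp)).continuousAt

lemma HolomorphicOffRay.mul_exp (hf : HolomorphicOffRay c f) (l : ℝ) :
    HolomorphicOffRay c fun s => f s * exp (l * s) := fun s hs => (hf s hs).mul (by fun_prop)

lemma HolomorphicOffRay.integrableOn_horizontal (hf : HolomorphicOffRay c f) (hd : 0 < d)
    (hl : 0 < l) (hM : ∀ s : ℂ, d ≤ |s.im| → ‖f s‖ ≤ M * Real.exp (l * s.re)) {y : ℝ}
    (hy : d ≤ |y|) : IntegrableOn (fun u : ℝ => f (u + y * I)) (Set.Iic c) :=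
  FoxH.integrableOn_horizontal hl
    (fun u _ => (hf _ (Or.inl (by simpa using abs_pos.1 (hd.trans_le hy)))).continuousAt)
    fun u _ => by simpa using hM (u + y * I) (by simpa using hy)

lemma leftLoopIntegral_add (hf : HolomorphicOffRay c f) (hg : HolomorphicOffRay c g) (hd : 0 < d)
    (hl : 0 < l) (hM : ∀ s : ℂ, d ≤ |s.im| → ‖f s‖ ≤ M * Real.exp (l * s.re))
    (hN : ∀ s : ℂ, d ≤ |s.im| → ‖g s‖ ≤ N * Real.exp (l * s.re)) {y₁ y₂ : ℝ}
    (h₁ : d ≤ |y₁|) (h₂ : d ≤ |y₂|) :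
    leftLoopIntegral c y₁ y₂ (fun s => f s + g s) =
      leftLoopIntegral c y₁ y₂ f + leftLoopIntegral c y₁ y₂ g := by
  have hfI := fun {y} => hf.integrableOn_horizontal hd hl hM (y := y)
  have hgI := fun {y} => hg.integrableOn_horizontal hd hl hN (y := y)
  have hfv : Continuous fun v : ℝ => f (c + v * I) * I := hf.continuous_vertical.mul_const I
  have hgv : Continuous fun v : ℝ => g (c + v * I) * I := hg.continuous_vertical.mul_const I
  simp only [leftLoopIntegral, add_mul]
  rw [integral_add (hfI h₁) (hgI h₁), integral_add (hfI h₂) (hgI h₂),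
    intervalIntegral.integral_add (hfv.intervalIntegrable _ _) (hgv.intervalIntegrable _ _)]
  ring

lemma leftLoopIntegral_widen (hf : HolomorphicOffRay c f) (hd : 0 < d) (hl : 0 < l)
    (hM : ∀ s : ℂ, d ≤ |s.im| → ‖f s‖ ≤ M * Real.exp (l * s.re)) {φ₁ φ₂ T : ℝ}
    (h₁ : φ₁ ≤ -d) (h₂ : d ≤ φ₂) (hT₁ : -T ≤ φ₁) (hT₂ : φ₂ ≤ T) :
    leftLoopIntegral c φ₁ φ₂ f = leftLoopIntegral c (-T) T f := by
  have hzero : ∀ {y₁ y₂ : ℝ}, y₁ ≤ y₂ → (∀ y ∈ Set.Icc y₁ y₂, d ≤ |y|) →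
      leftLoopIntegral c y₁ y₂ f = 0 := fun hy him =>
    leftLoopIntegral_eq_zero hl hy
      (fun s hs => hf s (Or.inl (abs_pos.1 (hd.trans_le (him _ hs.2)))))
      fun s hs => hM s (him _ hs.2)
  rw [← leftLoopIntegral_add_adjacent (y₁ := -T) (y₂ := φ₁) (y₃ := T) hf.continuous_vertical,
    ← leftLoopIntegral_add_adjacent (y₁ := φ₁) (y₂ := φ₂) (y₃ := T) hf.continuous_vertical,
    hzero hT₁ fun y hy => le_abs.2 (Or.inr (by linarith [hy.2])),
    hzero hT₂ fun y hy => le_abs.2 (Or.inl (by linarith [hy.1])), zero_add, add_zero]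

/-- The constant `ν` has no singularity inside the loop, so it does not contribute. -/
lemma leftLoopIntegral_add_const_mul_exp (hf : HolomorphicOffRay c f) (hd : 0 < d) (hl : 0 < l)
    (hM : ∀ s : ℂ, d ≤ |s.im| → ‖f s‖ ≤ M) (ν : ℂ) {T : ℝ} (hT : d ≤ T) :
    leftLoopIntegral c (-T) T (fun s => (f s + ν) * exp (l * s)) =
      leftLoopIntegral c (-T) T fun s => f s * exp (l * s) := by
  have hT' : d ≤ |T| := hT.trans (le_abs_self T)
  have hν : HolomorphicOffRay c fun s => ν * exp (l * s) := fun s _ => by fun_prop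
  have hνM : ∀ s : ℂ, ‖ν * exp (l * s)‖ ≤ ‖ν‖ * Real.exp (l * s.re) := fun s => by
    rw [norm_mul, norm_exp_ofReal_mul]
  simp_rw [add_mul]
  rw [leftLoopIntegral_add (M := M) (N := ‖ν‖) (hf.mul_exp l) hν hd hl (fun s hs => ?_)
    (fun s _ => hνM s) (by rwa [abs_neg]) hT', leftLoopIntegral_eq_zero (M := ‖ν‖) hl (by linarith)
    (fun s _ => by fun_prop) (fun s _ => hνM s), add_zero]
  rw [norm_mul, norm_exp_ofReal_mul]
  gcongr
  exact hM s hs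

end Loop

section Bounds

variable {c d C φ₁ φ₂ : ℝ} {G : ℂ → ℂ}

lemma DecaysOffAxis.exists_norm_le (hE : DecaysOffAxis G) (hd : 0 < d) :
    ∃ C : ℝ, 0 ≤ C ∧ ∀ s : ℂ, d ≤ |s.im| → ‖G s‖ ≤ C / |s.im| := by
  obtain ⟨C, hC0, hC⟩ := (hE.1 d hd).exists_nonneg
  refine ⟨C, hC0, fun s hs => ?_⟩
  simpa [div_eq_mul_inv] using Asymptotics.isBigOWith_principal.1 hC s hs

lemma exists_norm_vertical_le (hG : HolomorphicOffRay c G) (hE : DecaysOffAxis G) :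
    ∃ K : ℝ, ∀ v : ℝ, ‖G (c + v * I)‖ ≤ K := by
  obtain ⟨C, hC0, hC⟩ := hE.exists_norm_le one_pos
  obtain ⟨K, hK⟩ := (isCompact_Icc (a := (-1 : ℝ)) (b := 1)).exists_bound_of_continuousOn
    hG.continuous_vertical.continuousOn
  refine ⟨max K C, fun v => ?_⟩
  rcases le_total |v| 1 with hv | hv
  · exact (hK v (abs_le.1 hv)).trans (le_max_left _ _)
  · have h := hC (c + v * I) (by simpa using hv)
    simp only [add_im, ofReal_im, im_ofReal_mul, I_im, mul_one, zero_add] at h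
    exact h.trans ((div_le_self hC0 hv).trans (le_max_right _ _))

lemma loopTransform_eq (hG : HolomorphicOffRay c G) (hd : 0 < d)
    (hC : ∀ s : ℂ, d ≤ |s.im| → ‖G s‖ ≤ C / |s.im|) (hC0 : 0 ≤ C) (h₁ : φ₁ ≤ -d) (h₂ : d ≤ φ₂)
    (ν : ℂ) {T l : ℝ} (hT₁ : -T ≤ φ₁) (hT₂ : φ₂ ≤ T) (hl : 0 < l) :
    loopTransform c φ₁ φ₂ G ν l =
      (2 * (Real.pi : ℂ) * I)⁻¹ * leftLoopIntegral c (-T) T fun s => G s * exp (l * s) := by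
  have hM : ∀ s : ℂ, d ≤ |s.im| → ‖G s‖ ≤ C / d := fun s hs => (hC s hs).trans (by gcongr)
  have hGν : HolomorphicOffRay c fun s => (G s + ν) * exp (l * s) :=
    HolomorphicOffRay.mul_exp (fun s hs => (hG s hs).add_const ν) l
  rw [loopTransform, leftLoopIntegral_widen hGν hd hl (M := C / d + ‖ν‖) (fun s hs => ?_)
    h₁ h₂ hT₁ hT₂, leftLoopIntegral_add_const_mul_exp hG hd hl hM ν (h₂.trans hT₂)]
  rw [norm_mul, norm_exp_ofReal_mul]
  gcongr
  exact norm_add_le_of_le (hM s hs) le_rfl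

lemma norm_loopTransform_sub_verticalTransform_le (hG : HolomorphicOffRay c G) (hd : 0 < d)
    (hC : ∀ s : ℂ, d ≤ |s.im| → ‖G s‖ ≤ C / |s.im|) (hC0 : 0 ≤ C) (h₁ : φ₁ ≤ -d) (h₂ : d ≤ φ₂)
    (ν : ℂ) {T l : ℝ} (hT₁ : -T ≤ φ₁) (hT₂ : φ₂ ≤ T) (hl : 0 < l) :
    ‖loopTransform c φ₁ φ₂ G ν l - verticalTransform c G T l‖ ≤ C / T * (Real.exp (l * c) / l) := by
  have hTd : d ≤ T := h₂.trans hT₂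
  have hT : 0 < T := hd.trans_le hTd
  have hray : ∀ y : ℝ, |y| = T → ‖∫ u in Set.Iic c, G ((u : ℂ) + y * I) * exp (l * (u + y * I))‖ ≤
      C / T * (Real.exp (l * c) / l) := fun y hy =>
    norm_integral_horizontal_le (f := fun s => G s * exp (l * s)) hl fun u _ => by
      have him : |((u : ℂ) + y * I).im| = T := by simpa using hy
      have h := hC (u + y * I) (him ▸ hTd)
      rw [him] at h
      have hre : ((u : ℂ) + y * I).re = u := by simp
      rw [norm_mul, norm_exp_ofReal_mul, hre]
      gcongr
  have hpi : (Real.pi : ℂ) ≠ 0 := ofReal_ne_zero.2 Real.pi_ne_zero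
  have hdiff : loopTransform c φ₁ φ₂ G ν l - verticalTransform c G T l = (2 * (Real.pi : ℂ) * I)⁻¹ *
      ((∫ u in Set.Iic c, G ((u : ℂ) + (-T : ℝ) * I) * exp (l * (u + (-T : ℝ) * I))) -
        ∫ u in Set.Iic c, G ((u : ℂ) + T * I) * exp (l * (u + T * I))) := by
    rw [loopTransform_eq hG hd hC hC0 h₁ h₂ ν hT₁ hT₂ hl, verticalTransform, leftLoopIntegral,
      intervalIntegral.integral_mul_const]
    generalize (∫ v in -T..T, G (c + v * I) * exp (l * (c + v * I))) = V,
      (∫ u in Set.Iic c, G ((u : ℂ) + (-T : ℝ) * I) * exp (l * (u + (-T : ℝ) * I))) = Y,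
      (∫ u in Set.Iic c, G ((u : ℂ) + T * I) * exp (l * (u + T * I))) = Z
    field_simp
    ring
  have hnorm : ‖(2 * (Real.pi : ℂ) * I)⁻¹‖ = (2 * Real.pi)⁻¹ := by
    simp [abs_of_pos Real.pi_pos]
  rw [hdiff, norm_mul, hnorm]
  calc _ ≤ (2 * Real.pi)⁻¹ * (C / T * (Real.exp (l * c) / l) + C / T * (Real.exp (l * c) / l)) := by
        gcongr
        exact norm_sub_le_of_le (hray _ (by rw [abs_neg, abs_of_pos hT])) (hray _ (abs_of_pos hT))
    _ = Real.pi⁻¹ * (C / T * (Real.exp (l * c) / l)) := by field_simp; ring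
    _ ≤ _ := mul_le_of_le_one_left (by positivity)
      (inv_le_one_of_one_le₀ (by linarith [Real.pi_gt_three]))

lemma norm_verticalTransform_le {K : ℝ} (hK : ∀ v : ℝ, ‖G (c + v * I)‖ ≤ K)
    {T : ℝ} (hT : 0 ≤ T) (l : ℝ) :
    ‖verticalTransform c G T l‖ ≤ K * T * Real.exp (l * c) := by
  have hK0 : 0 ≤ K := (norm_nonneg _).trans (hK 0)
  have hint : ‖∫ v in -T..T, G (c + v * I) * exp (l * (c + v * I))‖ ≤
      K * Real.exp (l * c) * |T - -T| :=
    intervalIntegral.norm_integral_le_of_norm_le_const fun v _ => by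
      rw [norm_mul, norm_exp_ofReal_mul_vertical]
      gcongr
      exact hK v
  rw [sub_neg_eq_add, abs_of_nonneg (by linarith)] at hint
  have hnorm : ‖(2 * (Real.pi : ℂ))⁻¹‖ = (2 * Real.pi)⁻¹ := by simp [abs_of_pos Real.pi_pos]
  rw [verticalTransform, norm_mul, hnorm]
  calc _ ≤ (2 * Real.pi)⁻¹ * (K * Real.exp (l * c) * (T + T)) := by gcongr
    _ = Real.pi⁻¹ * (K * T * Real.exp (l * c)) := by field_simp; ring
    _ ≤ _ := mul_le_of_le_one_left (by positivity)
      (inv_le_one_of_one_le₀ (by linarith [Real.pi_gt_three]))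

lemma continuous_verticalTransform (hG : HolomorphicOffRay c G) (T : ℝ) :
    Continuous (verticalTransform c G T) := by
  refine continuous_const.mul
    (intervalIntegral.continuous_parametric_intervalIntegral_of_continuous' ?_ _ _)
  exact (hG.continuous_vertical.comp continuous_snd).mul (by fun_prop)

end Bounds

section Limit

variable {c φ₁ φ₂ : ℝ} {G : ℂ → ℂ}

lemma tendstoLocallyUniformlyOn_verticalTransform (hG : HolomorphicOffRay c G)
    (hE : DecaysOffAxis G) (hφ₁ : φ₁ < 0) (hφ₂ : 0 < φ₂) (ν : ℂ) :
    TendstoLocallyUniformlyOn (verticalTransform c G) (loopTransform c φ₁ φ₂ G ν) atTop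
      (Set.Ioi 0) := by
  have hd : 0 < min (-φ₁) φ₂ := lt_min (neg_pos.2 hφ₁) hφ₂
  obtain ⟨C, hC0, hC⟩ := hE.exists_norm_le hd
  rw [tendstoLocallyUniformlyOn_iff_forall_isCompact isOpen_Ioi]
  intro S hS hSc
  obtain ⟨D, hD⟩ := hSc.exists_bound_of_continuousOn (f := fun l : ℝ => Real.exp (l * c) / l)
    ((by fun_prop : Continuous fun l : ℝ => Real.exp (l * c)).continuousOn.div continuousOn_id
      fun l hl => (hS hl).ne')
  rw [Metric.tendstoUniformlyOn_iff]
  intro ε hε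
  have hlim : Tendsto (fun T : ℝ => C * D * T⁻¹) atTop (𝓝 0) := by
    simpa using tendsto_inv_atTop_zero.const_mul (C * D)
  filter_upwards [hlim.eventually_lt_const hε, eventually_gt_atTop 0, eventually_ge_atTop (-φ₁),
    eventually_ge_atTop φ₂] with T hT hT0 hT₁ hT₂ l hl
  rw [dist_eq_norm]
  calc _ ≤ C / T * (Real.exp (l * c) / l) :=
        norm_loopTransform_sub_verticalTransform_le hG hd hC hC0
          (le_neg_of_le_neg (min_le_left _ _)) (min_le_right _ _) ν (by linarith) hT₂ (hS hl)
    _ ≤ C / T * D := by gcongr; exact (le_abs_self _).trans (hD l hl)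
    _ = C * D * T⁻¹ := by ring
    _ < ε := hT

lemma continuousOn_loopTransform (hG : HolomorphicOffRay c G) (hE : DecaysOffAxis G)
    (hφ₁ : φ₁ < 0) (hφ₂ : 0 < φ₂) (ν : ℂ) :
    ContinuousOn (loopTransform c φ₁ φ₂ G ν) (Set.Ioi 0) :=
  (tendstoLocallyUniformlyOn_verticalTransform hG hE hφ₁ hφ₂ ν).continuousOn
    (Eventually.of_forall fun T => (continuous_verticalTransform hG T).continuousOn).frequently

/-- The trivial bound `K T` and the distance `O(1 / (T l))` to the limit balance at
`T = 1 + l ^ (-1/2)`, which makes the bound integrable at `l = 0`. -/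
lemma exists_norm_verticalTransform_le (hG : HolomorphicOffRay c G) (hE : DecaysOffAxis G) :
    ∃ D : ℝ, ∀ T l : ℝ, 0 ≤ T → 0 < l →
      ‖verticalTransform c G T l‖ ≤ D * ((1 + l ^ (-(1 / 2) : ℝ)) * Real.exp (l * c)) := by
  obtain ⟨K, hK⟩ := exists_norm_vertical_le hG hE
  obtain ⟨C, hC0, hC⟩ := hE.exists_norm_le one_pos
  have hK0 : 0 ≤ K := (norm_nonneg _).trans (hK 0)
  refine ⟨K + 2 * C, fun T l hT hl => ?_⟩
  set r : ℝ := l ^ (-(1 / 2) : ℝ) with hr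
  have hr0 : 0 < r := Real.rpow_pos_of_pos hl _
  have hrl : l⁻¹ = r * r := by
    rw [hr, ← Real.rpow_add hl, ← Real.rpow_neg_one]
    norm_num
  have hshort : ∀ S : ℝ, 0 ≤ S → S ≤ 1 + r →
      ‖verticalTransform c G S l‖ ≤ K * ((1 + r) * Real.exp (l * c)) := fun S hS hSr =>
    (norm_verticalTransform_le hK hS l).trans (by rw [mul_assoc]; gcongr)
  have hlong : ∀ S : ℝ, 1 + r ≤ S → ‖loopTransform c (-1) 1 G 0 l - verticalTransform c G S l‖ ≤
      C * ((1 + r) * Real.exp (l * c)) := fun S hS => by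
    calc _ ≤ C / S * (Real.exp (l * c) / l) :=
          norm_loopTransform_sub_verticalTransform_le hG one_pos hC hC0 le_rfl le_rfl 0
            (by linarith) (by linarith) hl
      _ ≤ C / r * (Real.exp (l * c) * (r * r)) := by
          rw [div_eq_mul_inv (Real.exp _), hrl]
          gcongr
          linarith
      _ = C * (r * Real.exp (l * c)) := by field_simp
      _ ≤ _ := by gcongr; linarith
  rcases le_total T (1 + r) with hTr | hTr
  · exact (hshort T hT hTr).trans (by gcongr; linarith)
  · calc ‖verticalTransform c G T l‖
        = ‖verticalTransform c G (1 + r) l +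
            (loopTransform c (-1) 1 G 0 l - verticalTransform c G (1 + r) l) -
            (loopTransform c (-1) 1 G 0 l - verticalTransform c G T l)‖ := by congr 1; ring
      _ ≤ K * ((1 + r) * Real.exp (l * c)) + C * ((1 + r) * Real.exp (l * c)) +
            C * ((1 + r) * Real.exp (l * c)) :=
          norm_sub_le_of_le (norm_add_le_of_le (hshort _ (by positivity) le_rfl)
            (hlong _ le_rfl)) (hlong T hTr)
      _ = _ := by ring

end Limit

section Laplace

variable {c x : ℝ} {G : ℂ → ℂ}

lemma integral_exp_vertical_mul (hx : c < x) (v : ℝ) :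
    ∫ l in Set.Ioi (0 : ℝ), exp ((c + v * I - x) * l) = (x - (c + v * I))⁻¹ := by
  have hre : ((c : ℂ) + v * I - x).re < 0 := by simpa using hx
  rw [integral_exp_mul_complex_Ioi hre]
  simp only [ofReal_zero, mul_zero, exp_zero]
  rw [neg_div, one_div, ← inv_neg, neg_sub]

lemma integrable_vertical_kernel (hG : HolomorphicOffRay c G) (hE : DecaysOffAxis G) (hx : c < x)
    (T : ℝ) : Integrable (fun z : ℝ × ℝ => G (c + z.2 * I) * exp ((c + z.2 * I - x) * z.1))
      ((volume.restrict (Set.Ioi 0)).prod (volume.restrict (Set.Ioc (-T) T))) := by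
  obtain ⟨K, hK⟩ := exists_norm_vertical_le hG hE
  have hdom : Integrable (fun z : ℝ × ℝ => Real.exp ((c - x) * z.1) * K)
      ((volume.restrict (Set.Ioi 0)).prod (volume.restrict (Set.Ioc (-T) T))) :=
    Integrable.mul_prod (f := fun l : ℝ => Real.exp ((c - x) * l)) (g := fun _ : ℝ => K)
      (integrableOn_exp_mul_Ioi (by linarith) 0) (integrable_const K)
  refine hdom.mono' (Continuous.aestronglyMeasurable
    ((hG.continuous_vertical.comp continuous_snd).mul (by fun_prop)))
    (Eventually.of_forall fun z => ?_)
  have hexp : ‖exp ((c + z.2 * I - x) * z.1)‖ = Real.exp ((c - x) * z.1) := by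
    rw [norm_exp, re_mul_ofReal]
    simp
  rw [norm_mul, hexp, mul_comm]
  gcongr
  exact hK _

lemma integral_verticalTransform_mul_exp (hG : HolomorphicOffRay c G) (hE : DecaysOffAxis G)
    {T : ℝ} (hT : 0 ≤ T) (hx : c < x) :
    ∫ l in Set.Ioi (0 : ℝ), verticalTransform c G T l * exp (-(x * l)) =
      (2 * (Real.pi : ℂ))⁻¹ * ∫ v in -T..T, G (c + v * I) / (x - (c + v * I)) := by
  have hTT : -T ≤ T := neg_le_self hT
  have hinner : ∀ l : ℝ, verticalTransform c G T l * exp (-(x * l)) = (2 * (Real.pi : ℂ))⁻¹ *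
      ∫ v in Set.Ioc (-T) T, G (c + v * I) * exp ((c + v * I - x) * l) := fun l => by
    rw [verticalTransform, mul_assoc, ← intervalIntegral.integral_mul_const,
      intervalIntegral.integral_of_le hTT]
    congr 1
    refine integral_congr_ae (Eventually.of_forall fun v => ?_)
    simp only [mul_assoc, ← exp_add]
    ring_nf
  simp_rw [hinner]
  rw [integral_const_mul, integral_integral_swap (integrable_vertical_kernel hG hE hx T),
    intervalIntegral.integral_of_le hTT]
  simp_rw [integral_const_mul, integral_exp_vertical_mul hx, div_eq_mul_inv]

lemma integrableOn_one_add_rpow_mul_exp (hx : c < x) :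
    IntegrableOn (fun l : ℝ => (1 + l ^ (-(1 / 2) : ℝ)) * Real.exp (l * c) * Real.exp (-(x * l)))
      (Set.Ioi 0) := by
  have h := (integrableOn_exp_mul_Ioi (show c - x < 0 by linarith) 0).add
    (integrableOn_rpow_mul_exp_neg_mul_rpow (s := -(1 / 2)) (by norm_num) one_pos (sub_pos.2 hx))
  refine h.congr_fun (fun l _ => ?_) measurableSet_Ioi
  simp only [Pi.add_apply, Real.rpow_one]
  rw [mul_assoc, ← Real.exp_add, add_mul, one_mul]
  ring_nf

variable {φ₁ φ₂ : ℝ} (hG : HolomorphicOffRay c G) (hE : DecaysOffAxis G) (hφ₁ : φ₁ < 0)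
  (hφ₂ : 0 < φ₂) (ν : ℂ) (hx : c < x)

include hG hE hφ₁ hφ₂ hx

lemma exists_bound_laplace :
    ∃ bound : ℝ → ℝ, IntegrableOn bound (Set.Ioi 0) ∧
      (∀ T l : ℝ, 0 ≤ T → 0 < l → ‖verticalTransform c G T l * exp (-(x * l))‖ ≤ bound l) ∧
      ∀ l : ℝ, 0 < l → ‖loopTransform c φ₁ φ₂ G ν l * exp (-(x * l))‖ ≤ bound l := by
  obtain ⟨D, hD⟩ := exists_norm_verticalTransform_le hG hE
  have hnorm : ∀ l : ℝ, ‖exp (-((x : ℂ) * l))‖ = Real.exp (-(x * l)) := fun l => by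
    rw [norm_exp]
    simp
  have hvert : ∀ T l : ℝ, 0 ≤ T → 0 < l → ‖verticalTransform c G T l * exp (-(x * l))‖ ≤
      D * ((1 + l ^ (-(1 / 2) : ℝ)) * Real.exp (l * c) * Real.exp (-(x * l))) :=
    fun T l hT hl => by
      rw [norm_mul, hnorm, ← mul_assoc D]
      gcongr
      exact hD T l hT hl
  refine ⟨_, (integrableOn_one_add_rpow_mul_exp hx).const_mul D, hvert, fun l hl => ?_⟩
  exact le_of_tendsto (((tendstoLocallyUniformlyOn_verticalTransform hG hE hφ₁ hφ₂ ν).tendsto_at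
    hl).mul_const _).norm ((eventually_ge_atTop 0).mono fun T hT => hvert T l hT hl)

lemma integrableOn_loopTransform_mul_exp :
    IntegrableOn (fun l : ℝ => loopTransform c φ₁ φ₂ G ν l * exp (-(x * l))) (Set.Ioi 0) := by
  obtain ⟨bound, hint, -, hloop⟩ := exists_bound_laplace hG hE hφ₁ hφ₂ ν hx
  exact Integrable.mono' hint (((continuousOn_loopTransform hG hE hφ₁ hφ₂ ν).mul
    (by fun_prop)).aestronglyMeasurable measurableSet_Ioi)
    (ae_restrict_of_forall_mem measurableSet_Ioi hloop)

theorem integral_loopTransform_mul_exp :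
    ∫ l in Set.Ioi (0 : ℝ), loopTransform c φ₁ φ₂ G ν l * exp (-(x * l)) = G x := by
  obtain ⟨bound, hint, hvert, -⟩ := exists_bound_laplace hG hE hφ₁ hφ₂ ν hx
  have hdom : Tendsto (fun T : ℝ => ∫ l in Set.Ioi (0 : ℝ),
      verticalTransform c G T l * exp (-(x * l))) atTop
      (𝓝 (∫ l in Set.Ioi (0 : ℝ), loopTransform c φ₁ φ₂ G ν l * exp (-(x * l)))) :=
    tendsto_integral_filter_of_dominated_convergence bound
      (Eventually.of_forall fun T =>
        ((continuous_verticalTransform hG T).mul (by fun_prop)).aestronglyMeasurable)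
      ((eventually_ge_atTop 0).mono fun T hT =>
        ae_restrict_of_forall_mem measurableSet_Ioi fun l hl => hvert T l hT hl) hint
      (ae_restrict_of_forall_mem measurableSet_Ioi fun l hl =>
        ((tendstoLocallyUniformlyOn_verticalTransform hG hE hφ₁ hφ₂ ν).tendsto_at hl).mul_const _)
  have hcauchy := (tendsto_integral_cauchy_halfPlane (fun s hs => hG s (Or.inr hs))
    (hE.isBigO_halfPlane c) hx).const_mul (2 * (Real.pi : ℂ))⁻¹
  rw [inv_mul_cancel_left₀ (mul_ne_zero two_ne_zero (ofReal_ne_zero.2 Real.pi_ne_zero))] at hcauchy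
  exact tendsto_nhds_unique hdom (hcauchy.congr' ((eventually_ge_atTop 0).mono fun T hT =>
    (integral_verticalTransform_mul_exp hG hE hT hx).symm))

end Laplace

/-! ### The Fox function -/

section FoxFunction

variable {p q : ℕ} {A a : Fin p → ℝ} {B b : Fin q → ℝ} {c : ℝ}

lemma affine_ne_neg_nat (hA : ∀ k, 0 < A k) (hc : ∀ k, -a k / A k < c) {s : ℂ}
    (hs : s.im ≠ 0 ∨ c ≤ s.re) (k : Fin p) (m : ℕ) : (A k : ℂ) * s + a k ≠ -m := fun h => by
  have him : A k * s.im = 0 := by simpa using congrArg im h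
  have hre : A k * s.re + a k = -m := by simpa using congrArg re h
  rcases hs with hs | hs
  · exact hs ((mul_eq_zero.1 him).resolve_left (hA k).ne')
  · have hpole := (div_lt_iff₀ (hA k)).1 ((hc k).trans_le hs)
    linarith [m.cast_nonneg (α := ℝ)]

lemma differentiable_prod_inv_Gamma (A a : Fin p → ℝ) :
    Differentiable ℂ fun s : ℂ => ∏ k, (Gamma (A k * s + a k))⁻¹ :=
  Differentiable.fun_finsetProd fun k _ => differentiable_one_div_Gamma.comp (by fun_prop)

lemma differentiableAt_gammaRatioC (hA : ∀ k, 0 < A k) (hc : ∀ k, -a k / A k < c) {s : ℂ}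
    (hs : s.im ≠ 0 ∨ c ≤ s.re) : DifferentiableAt ℂ (gammaRatioC A a B b) s := by
  have hnum : DifferentiableAt ℂ (fun s : ℂ => ∏ k, Gamma (A k * s + a k)) s :=
    DifferentiableAt.fun_finsetProd fun k _ =>
      (differentiableAt_Gamma _ (affine_ne_neg_nat hA hc hs k)).comp s (by fun_prop)
  refine (hnum.fun_mul (differentiable_prod_inv_Gamma B b s)).congr_of_eventuallyEq
    (Eventually.of_forall fun z => ?_)
  simp only [gammaRatioC, Finset.prod_inv_distrib, div_eq_mul_inv]

lemma holomorphicOffRay_normRatio_sub_nu (hA : ∀ k, 0 < A k) (hc : ∀ k, -a k / A k < c) :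
    HolomorphicOffRay c fun s => normRatio A a B b s - nu A a B b := fun _ hs =>
  ((differentiableAt_gammaRatioC hA hc hs).mul (by fun_prop)).sub_const _

lemma gammaRatioC_ofReal (A a : Fin p → ℝ) (B b : Fin q → ℝ) (x : ℝ) :
    gammaRatioC A a B b x = gammaRatio A a B b x := by
  simp only [gammaRatioC, gammaRatio, ofReal_div, ofReal_prod, ← Gamma_ofReal, ofReal_add,
    ofReal_mul]

lemma foxH_exp_neg (c φ₁ φ₂ : ℝ) (A a : Fin p → ℝ) (B b : Fin q → ℝ) (t : ℝ) :
    foxH c φ₁ φ₂ A a B b (Real.exp (-t)) =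
      loopTransform c φ₁ φ₂ (fun s => normRatio A a B b s - nu A a B b) (nu A a B b)
        (t + Real.log (rho A B)) := by
  have hcpow : ∀ s : ℂ, (Real.exp (-t) : ℂ) ^ (-s) = exp (t * s) := fun s => by
    rw [cpow_def_of_ne_zero (ofReal_ne_zero.2 (Real.exp_pos _).ne'),
      ← ofReal_log (Real.exp_pos _).le, Real.log_exp]
    push_cast
    ring_nf
  simp_rw [foxH, loopTransform, sub_add_cancel, normRatio, hcpow, mul_assoc, ← exp_add]
  push_cast
  ring_nf

lemma foxH_exp_neg_mul_exp (c φ₁ φ₂ : ℝ) (A a : Fin p → ℝ) (B b : Fin q → ℝ) (x t : ℝ) :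
    foxH c φ₁ φ₂ A a B b (Real.exp (-t)) * exp (-(x * t)) =
      loopTransform c φ₁ φ₂ (fun s => normRatio A a B b s - nu A a B b) (nu A a B b)
        (t + Real.log (rho A B)) * exp (-(x * (t + Real.log (rho A B) : ℝ))) *
          exp (x * Real.log (rho A B)) := by
  rw [foxH_exp_neg, mul_assoc, ← exp_add]
  congr 2
  push_cast
  ring

lemma setIntegral_Ioi_neg_comp_add (f : ℝ → ℂ) (r : ℝ) :
    ∫ t in Set.Ioi (-r), f (t + r) = ∫ t in Set.Ioi 0, f t := by
  simpa using (measurePreserving_add_right volume r).setIntegral_preimage_emb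
    (measurableEmbedding_addRight r) f (Set.Ioi 0)

lemma integrableOn_Ioi_neg_comp_add {f : ℝ → ℂ} (hf : IntegrableOn f (Set.Ioi 0)) (r : ℝ) :
    IntegrableOn (fun t => f (t + r)) (Set.Ioi (-r)) := by
  simpa [Function.comp_def] using ((measurePreserving_add_right volume r).integrableOn_comp_preimage
    (measurableEmbedding_addRight r)).2 hf

variable (hA : ∀ k, 0 < A k) (hB : ∀ j, 0 < B j) (hΔ : ∑ j, B j = ∑ k, A k) (hμ : mu a b = 0)
  {φ₁ φ₂ : ℝ} (hφ₁ : φ₁ < 0) (hφ₂ : 0 < φ₂) (hc : ∀ k, -a k / A k < c)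

include hA hB hΔ hμ hφ₁ hφ₂ hc

lemma continuousOn_foxH_exp_neg :
    ContinuousOn (fun t : ℝ => foxH c φ₁ φ₂ A a B b (Real.exp (-t)))
      (Set.Ioi (-Real.log (rho A B))) := by
  simp_rw [foxH_exp_neg]
  exact (continuousOn_loopTransform (holomorphicOffRay_normRatio_sub_nu hA hc)
    (decaysOffAxis_normRatio_sub_nu hA hB hΔ hμ) hφ₁ hφ₂ _).comp (by fun_prop)
    fun t ht => Set.mem_Ioi.2 (neg_lt_iff_pos_add.1 ht)

variable {x : ℝ} (hx : c < x)

include hx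

lemma integrableOn_foxH_mul_exp :
    IntegrableOn (fun t : ℝ => foxH c φ₁ φ₂ A a B b (Real.exp (-t)) * exp (-(x * t)))
      (Set.Ioi (-Real.log (rho A B))) := by
  simp_rw [foxH_exp_neg_mul_exp]
  exact (integrableOn_Ioi_neg_comp_add (integrableOn_loopTransform_mul_exp
    (holomorphicOffRay_normRatio_sub_nu hA hc) (decaysOffAxis_normRatio_sub_nu hA hB hΔ hμ)
    hφ₁ hφ₂ _ hx) _).mul_const _

theorem gammaRatio_eq_add_integral_foxH :
    (gammaRatio A a B b x : ℂ) = nu A a B b * exp (-(x * (-Real.log (rho A B) : ℝ))) +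
      ∫ t in Set.Ioi (-Real.log (rho A B)),
        foxH c φ₁ φ₂ A a B b (Real.exp (-t)) * exp (-(x * t)) := by
  simp_rw [foxH_exp_neg_mul_exp]
  rw [integral_mul_const, setIntegral_Ioi_neg_comp_add (fun l : ℝ => loopTransform c φ₁ φ₂
    (fun s => normRatio A a B b s - nu A a B b) (nu A a B b) l * exp (-(x * l))),
    integral_loopTransform_mul_exp (holomorphicOffRay_normRatio_sub_nu hA hc)
      (decaysOffAxis_normRatio_sub_nu hA hB hΔ hμ) hφ₁ hφ₂ _ hx, normRatio, gammaRatioC_ofReal,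
    sub_mul, mul_assoc, ← exp_add]
  push_cast
  simp

end FoxFunction

/-! ### The Post–Widder inversion -/

section LaplaceDerivatives

variable {m : Measure ℝ} {g : ℝ → ℂ} {c : ℝ} (hm : ∀ᵐ t ∂m, 0 ≤ t)
  (hint : ∀ x : ℝ, c < x → Integrable (fun t : ℝ => g t * exp (-(x * t))) m)

include hm hint

lemma integrable_pow_mul_laplace (n : ℕ) {x : ℝ} (hx : c < x) :
    Integrable (fun t : ℝ => (t : ℂ) ^ n * (g t * exp (-(x * t)))) m := by
  obtain ⟨y, hcy, hyx⟩ := exists_between hx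
  have : 0 < x - y := sub_pos.2 hyx
  refine Integrable.mono' ((hint y hcy).norm.const_mul (n.factorial / (x - y) ^ n))
    ((by fun_prop : Continuous fun t : ℝ => (t : ℂ) ^ n).aestronglyMeasurable.mul (hint x hx).1) ?_
  filter_upwards [hm] with t ht
  have hpow : t ^ n ≤ n.factorial / (x - y) ^ n * Real.exp ((x - y) * t) := by
    have hexp := Real.pow_div_factorial_le_exp ((x - y) * t) (by positivity) n
    rw [div_le_iff₀ (by positivity), mul_pow] at hexp
    rw [div_mul_eq_mul_div, le_div_iff₀ (by positivity)]
    linarith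
  simp only [norm_mul, norm_pow, norm_exp, norm_real, Real.norm_of_nonneg ht, neg_re,
    re_ofReal_mul, ofReal_re]
  calc t ^ n * (‖g t‖ * Real.exp (-(x * t)))
      ≤ (n.factorial / (x - y) ^ n * Real.exp ((x - y) * t)) *
        (‖g t‖ * Real.exp (-(x * t))) := by gcongr
    _ = n.factorial / (x - y) ^ n * (‖g t‖ * (Real.exp ((x - y) * t) * Real.exp (-(x * t)))) := by
        ring
    _ = n.factorial / (x - y) ^ n * (‖g t‖ * Real.exp (-(y * t))) := by
        rw [← Real.exp_add]; ring_nf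

lemma hasDerivAt_integral_pow_mul_laplace (n : ℕ) {x : ℝ} (hx : c < x) :
    HasDerivAt (fun x : ℝ => ∫ t : ℝ, (t : ℂ) ^ n * (g t * exp (-(x * t))) ∂m)
      (-∫ t : ℝ, (t : ℂ) ^ (n + 1) * (g t * exp (-(x * t))) ∂m) x := by
  obtain ⟨y, hcy, hyx⟩ := exists_between hx
  rw [← integral_neg]
  refine (hasDerivAt_integral_of_dominated_loc_of_deriv_le
    (F' := fun (x : ℝ) (t : ℝ) => -((t : ℂ) ^ (n + 1) * (g t * exp (-(x * t)))))
    (bound := fun t : ℝ => ‖(t : ℂ) ^ (n + 1) * (g t * exp (-(y * t)))‖)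
    (Ioi_mem_nhds hyx) ?_ (integrable_pow_mul_laplace hm hint n hx)
    (integrable_pow_mul_laplace hm hint (n + 1) hx).1.neg ?_
    (integrable_pow_mul_laplace hm hint (n + 1) hcy).norm ?_).2
  · filter_upwards [Ioi_mem_nhds hx] with z hz
    exact (integrable_pow_mul_laplace hm hint n hz).1
  · filter_upwards [hm] with t ht z (hz : y < z)
    simp only [norm_neg, norm_mul, norm_exp, neg_re, re_ofReal_mul, ofReal_re]
    gcongr
  · refine Eventually.of_forall fun t z _ => ?_
    have hz : HasDerivAt (fun z : ℝ => (z : ℂ)) 1 z := (hasDerivAt_id _).comp_ofReal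
    refine (((((hz.mul_const (t : ℂ)).fun_neg).cexp).const_mul (g t)).const_mul
      ((t : ℂ) ^ n)).congr_deriv ?_
    ring

lemma iteratedDeriv_eq_integral_of_laplace {W : ℝ → ℝ}
    (hW : ∀ x : ℝ, c < x → (W x : ℂ) = ∫ t : ℝ, g t * exp (-(x * t)) ∂m) (n : ℕ) {x : ℝ}
    (hx : c < x) : ((iteratedDeriv n W x : ℝ) : ℂ) =
      (-1) ^ n * ∫ t : ℝ, (t : ℂ) ^ n * (g t * exp (-(x * t))) ∂m := by
  induction n generalizing x with
  | zero => simpa using hW x hx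
  | succ n ih =>
    set D : ℂ := (-1) ^ n * -∫ t : ℝ, (t : ℂ) ^ (n + 1) * (g t * exp (-(x * t))) ∂m with hD
    have hderiv : HasDerivAt (fun z : ℝ => ((iteratedDeriv n W z : ℝ) : ℂ)) D x :=
      ((hasDerivAt_integral_pow_mul_laplace hm hint n hx).const_mul _).congr_of_eventuallyEq
        (by filter_upwards [Ioi_mem_nhds hx] with z hz using ih hz)
    have hderivRe : HasDerivAt (iteratedDeriv n W) D.re x := by
      simpa [Function.comp_def] using reCLM.hasFDerivAt.comp_hasDerivAt x hderiv
    rw [iteratedDeriv_succ, hderivRe.deriv, ← hderiv.unique hderivRe.ofReal_comp, hD, pow_succ]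
    ring

end LaplaceDerivatives

section Peak

variable {α E : Type*} [TopologicalSpace α] [MeasurableSpace α] [BorelSpace α]
  [NormedAddCommGroup E] [NormedSpace ℝ E] [CompleteSpace E] {m : Measure α} {s t : Set α}
  {k : α → ℝ} {x₀ : α}

omit [MeasurableSpace α] [BorelSpace α] in
lemma exists_lt_forall_le_of_tendsto_cocompact (hs : IsClosed s) (hk : ContinuousOn k s)
    (hk₀ : 0 < k x₀) (hmax : ∀ x ∈ s, k x < k x₀)
    (hlim : Tendsto k (cocompact α ⊓ 𝓟 s) (𝓝 0)) : ∃ Q, 0 ≤ Q ∧ Q < k x₀ ∧ ∀ x ∈ s, k x ≤ Q := by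
  by_cases hpos : ∃ y ∈ s, 0 < k y
  · obtain ⟨y, hys, hy⟩ := hpos
    obtain ⟨z, hzs, hz⟩ := hk.exists_isMaxOn' hs hys
      ((hlim.eventually_lt_const hy).mono fun x hx => hx.le)
    exact ⟨k z, hy.le.trans (hz hys), hmax z hzs, fun x hx => hz hx⟩
  · push Not at hpos
    exact ⟨0, le_rfl, hk₀, hpos⟩

lemma exists_mul_pow_le_setIntegral_pow [T2Space α] [IsFiniteMeasureOnCompacts m]
    (ht : IsCompact t) (htx : t ∈ 𝓝 x₀) (hmx : ∀ u ∈ 𝓝 x₀, 0 < m u) (hk : Continuous k)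
    (hk₀ : ∀ x ∈ t, 0 ≤ k x) {r : ℝ} (hr₀ : 0 ≤ r) (hr : r < k x₀) :
    ∃ δ > 0, ∀ n : ℕ, δ * r ^ n ≤ ∫ x in t, k x ^ n ∂m := by
  set v := t ∩ k ⁻¹' Set.Ioi r
  have hvm : MeasurableSet v := ht.measurableSet.inter (hk.measurable measurableSet_Ioi)
  have hvfin : m v < ⊤ := (measure_mono Set.inter_subset_left).trans_lt ht.measure_lt_top
  have hint : ∀ n, IntegrableOn (fun x => k x ^ n) t m := fun n =>
    (hk.pow n).continuousOn.integrableOn_compact ht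
  refine ⟨m.real v, ENNReal.toReal_pos
    (hmx v (inter_mem htx (hk.continuousAt.eventually_const_lt hr))).ne' hvfin.ne, fun n => ?_⟩
  calc m.real v * r ^ n = ∫ _ in v, r ^ n ∂m := by rw [setIntegral_const, smul_eq_mul]
    _ ≤ ∫ x in v, k x ^ n ∂m :=
      setIntegral_mono_on (integrableOn_const hvfin.ne) ((hint n).mono_set Set.inter_subset_left)
        hvm fun x hx => pow_le_pow_left₀ hr₀ hx.2.le n
    _ ≤ ∫ x in t, k x ^ n ∂m :=
      setIntegral_mono_set (hint n) ((ae_restrict_mem ht.measurableSet).mono fun x hx =>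
        pow_nonneg (hk₀ x hx) n) (Set.inter_subset_left).eventuallyLE

variable [T2Space α] [IsFiniteMeasureOnCompacts m] (ht : IsCompact t) (hts : t ⊆ s)
  (htx : t ∈ 𝓝 x₀) (hmx : ∀ u ∈ 𝓝 x₀, 0 < m u) (hk : Continuous k) (hk₀ : ∀ x ∈ s, 0 ≤ k x)
  (hkx : 0 < k x₀)

include ht hts htx hmx hk hk₀ hkx

lemma setIntegral_pow_pos (n : ℕ) : 0 < ∫ x in t, k x ^ n ∂m := by
  obtain ⟨r, hr, hrk⟩ := exists_between hkx
  obtain ⟨δ, hδ, hle⟩ := exists_mul_pow_le_setIntegral_pow ht htx hmx hk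
    (fun x hx => hk₀ x (hts hx)) hr.le hrk
  exact (by positivity : 0 < δ * r ^ n).trans_le (hle n)

lemma inv_setIntegral_pow_mul_pow_nonneg (n : ℕ) {x : α} (hx : x ∈ s) :
    0 ≤ (∫ x in t, k x ^ n ∂m)⁻¹ * k x ^ n :=
  mul_nonneg (inv_nonneg.2 (setIntegral_pow_pos ht hts htx hmx hk hk₀ hkx n).le)
    (pow_nonneg (hk₀ x hx) n)

variable (hs : IsClosed s) (hmax : ∀ x ∈ s, x ≠ x₀ → k x < k x₀)
  (hlim : Tendsto k (cocompact α ⊓ 𝓟 s) (𝓝 0))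

include hs hmax hlim

lemma tendstoUniformlyOn_inv_setIntegral_pow_mul_pow {u : Set α} (hu : IsOpen u) (hxu : x₀ ∈ u) :
    TendstoUniformlyOn (fun (n : ℕ) x => (∫ x in t, k x ^ n ∂m)⁻¹ * k x ^ n) 0 atTop (s \ u) := by
  obtain ⟨Q, hQ₀, hQ, hle⟩ := exists_lt_forall_le_of_tendsto_cocompact (hs.sdiff hu)
    hk.continuousOn hkx (fun x hx => hmax x hx.1 fun h => hx.2 (h ▸ hxu))
    (hlim.mono_left (inf_le_inf_left _ (principal_mono.2 Set.sdiff_subset)))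
  obtain ⟨r, hQr, hrk⟩ := exists_between hQ
  have hr : 0 < r := hQ₀.trans_lt hQr
  obtain ⟨δ, hδ, hZle⟩ := exists_mul_pow_le_setIntegral_pow ht htx hmx hk
    (fun x hx => hk₀ x (hts hx)) hr.le hrk
  have hzero : Tendsto (fun n : ℕ => δ⁻¹ * (Q / r) ^ n) atTop (𝓝 0) := by
    simpa using (tendsto_pow_atTop_nhds_zero_of_lt_one (by positivity)
      ((div_lt_one hr).2 hQr)).const_mul δ⁻¹
  refine Metric.tendstoUniformlyOn_iff.2 fun ε hε => ?_
  filter_upwards [hzero.eventually_lt_const hε] with n hn x hx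
  rw [Pi.zero_apply, dist_zero_left,
    Real.norm_of_nonneg (inv_setIntegral_pow_mul_pow_nonneg ht hts htx hmx hk hk₀ hkx n hx.1)]
  calc (∫ x in t, k x ^ n ∂m)⁻¹ * k x ^ n ≤ (δ * r ^ n)⁻¹ * Q ^ n := by
        gcongr
        exacts [pow_nonneg (hk₀ x hx.1) n, hZle n, hk₀ x hx.1, hle x hx]
    _ = δ⁻¹ * (Q / r) ^ n := by rw [div_pow]; field_simp
    _ < ε := hn

theorem tendsto_inv_setIntegral_pow_smul_setIntegral {g : α → E} (hg : IntegrableOn g s m)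
    (hgx : ContinuousAt g x₀) :
    Tendsto (fun n : ℕ => (∫ x in t, k x ^ n ∂m)⁻¹ • ∫ x in s, k x ^ n • g x ∂m) atTop
      (𝓝 (g x₀)) := by
  have hone : ∀ n : ℕ, ∫ x in t, (∫ x in t, k x ^ n ∂m)⁻¹ * k x ^ n ∂m = 1 := fun n => by
    rw [integral_const_mul,
      inv_mul_cancel₀ (setIntegral_pow_pos ht hts htx hmx hk hk₀ hkx n).ne']
  have hpeak := tendsto_setIntegral_peak_smul_of_integrableOn_of_tendsto hs.measurableSet
    ht.measurableSet hts (mem_nhdsWithin_of_mem_nhds htx) ht.measure_lt_top.ne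
    (Eventually.of_forall fun n x hx =>
      inv_setIntegral_pow_mul_pow_nonneg ht hts htx hmx hk hk₀ hkx n hx)
    (fun u => tendstoUniformlyOn_inv_setIntegral_pow_mul_pow ht hts htx hmx hk hk₀ hkx hs hmax hlim)
    (by simp only [hone, tendsto_const_nhds])
    (Eventually.of_forall fun n => (by fun_prop : Continuous fun x =>
      (∫ x in t, k x ^ n ∂m)⁻¹ * k x ^ n).aestronglyMeasurable) hg hgx.continuousWithinAt
  simpa only [mul_smul, integral_smul] using hpeak

end Peak

section PostWidder

lemma mul_exp_neg_div_lt {t t₁ : ℝ} (ht₁ : 0 < t₁) (ht : t ≠ t₁) :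
    t * Real.exp (-(t / t₁)) < t₁ * Real.exp (-(t₁ / t₁)) := by
  have hne : t / t₁ - 1 ≠ 0 := fun h => ht ((div_eq_one_iff_eq ht₁.ne').1 (sub_eq_zero.1 h))
  have hlt := Real.add_one_lt_exp hne
  rw [sub_add_cancel, Real.exp_sub, div_lt_div_iff₀ ht₁ (Real.exp_pos _)] at hlt
  rw [div_self ht₁.ne', Real.exp_neg, Real.exp_neg, ← div_eq_mul_inv, ← div_eq_mul_inv,
    div_lt_div_iff₀ (Real.exp_pos _) (Real.exp_pos _)]
  linarith

lemma tendsto_mul_exp_neg_div {t₁ : ℝ} (ht₁ : 0 < t₁) :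
    Tendsto (fun t => t * Real.exp (-(t / t₁))) atTop (𝓝 0) := by
  have hlim := ((Real.tendsto_pow_mul_exp_neg_atTop_nhds_zero 1).comp
    (tendsto_id.atTop_div_const ht₁)).const_mul t₁
  rw [mul_zero] at hlim
  refine hlim.congr fun t => ?_
  simp only [Function.comp_apply, id, pow_one]
  field_simp

lemma integral_mul_exp_neg_pow_smul (m : Measure ℝ) (g : ℝ → ℂ) (t₁ x : ℝ) (n : ℕ) :
    ∫ t : ℝ, (t * Real.exp (-(t / t₁))) ^ n • (g t * exp (-(x * t))) ∂m =
      ∫ t : ℝ, (t : ℂ) ^ n * (g t * exp (-((x + n / t₁ : ℝ) * t))) ∂m := by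
  have hexp : ∀ t : ℝ, exp (-((x + n / t₁ : ℝ) * t)) = exp (-(t / t₁)) ^ n * exp (-(x * t)) :=
    fun t => by
      rw [← exp_nat_mul, ← exp_add]
      congr 1
      push_cast
      field_simp
      ring
  simp_rw [hexp, real_smul]
  push_cast
  congr with t
  ring

/- Post and Widder: up to a constant, `(-1) ^ n * W⁽ⁿ⁾ (x + n / t₁)` is the integral of
`g t * exp (-(x * t))` against the `n`-th power of the kernel `t * exp (-(t / t₁))`, which has its
maximum at `t₁`. -/
theorem nonneg_of_laplace_of_iteratedDeriv_nonneg {m : Measure ℝ} [IsLocallyFiniteMeasure m]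
    {g : ℝ → ℂ} {W : ℝ → ℝ} {c t₁ : ℝ} (hm : ∀ᵐ t ∂m, 0 ≤ t)
    (hint : ∀ x : ℝ, c < x → Integrable (fun t : ℝ => g t * exp (-(x * t))) m)
    (hW : ∀ x : ℝ, c < x → (W x : ℂ) = ∫ t : ℝ, g t * exp (-(x * t)) ∂m)
    (hsign : ∀ (n : ℕ) (x : ℝ), c < x → 0 ≤ (-1 : ℝ) ^ n * iteratedDeriv n W x)
    (ht₁ : 0 < t₁) (hmt : ∀ u ∈ 𝓝 t₁, 0 < m u) (hg : ContinuousAt g t₁) : 0 ≤ g t₁ := by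
  obtain ⟨x, hx⟩ := exists_gt c
  have hm₀ : m.restrict (Set.Ici 0) = m := Measure.restrict_eq_self_of_ae_mem hm
  have hcocompact : cocompact ℝ ⊓ 𝓟 (Set.Ici 0) ≤ atTop := by
    have hdisj : Disjoint (atBot : Filter ℝ) (𝓟 (Set.Ici 0)) :=
      disjoint_principal_right.2 ((eventually_lt_atBot 0).mono fun t ht => not_le.2 ht)
    rw [cocompact_eq_atBot_atTop, inf_sup_right, hdisj.eq_bot, bot_sup_eq]
    exact inf_le_left
  have hlim := tendsto_inv_setIntegral_pow_smul_setIntegral (s := Set.Ici 0)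
    (isCompact_Icc (a := 0) (b := t₁ + 1)) (fun t ht => ht.1)
    (Icc_mem_nhds ht₁ (lt_add_one t₁)) hmt (by fun_prop)
    (fun t ht => mul_nonneg ht (Real.exp_pos _).le) (by positivity) isClosed_Ici
    (fun t _ ht => mul_exp_neg_div_lt ht₁ ht) ((tendsto_mul_exp_neg_div ht₁).mono_left hcocompact)
    (hint x hx).integrableOn (hg.mul (by fun_prop))
  have hpos : 0 ≤ g t₁ * exp (-(x * t₁)) := by
    refine ge_of_tendsto' hlim fun n => ?_
    have hxn : c < x + n / t₁ := hx.trans_le (le_add_of_nonneg_right (by positivity))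
    have hder : ∫ t : ℝ, (t : ℂ) ^ n * (g t * exp (-((x + n / t₁ : ℝ) * t))) ∂m =
        ((-1 : ℝ) ^ n * iteratedDeriv n W (x + n / t₁) : ℝ) := by
      push_cast
      rw [iteratedDeriv_eq_integral_of_laplace hm hint hW n hxn, ← mul_assoc, ← mul_pow]
      simp
    rw [hm₀, integral_mul_exp_neg_pow_smul, hder, real_smul, ← ofReal_mul]
    exact zero_le_real.2 (mul_nonneg (inv_nonneg.2 (setIntegral_nonneg measurableSet_Icc
      fun t ht => pow_nonneg (mul_nonneg ht.1 (Real.exp_pos _).le) n)) (hsign n _ hxn))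
  have hexp : (0 : ℂ) ≤ exp (x * t₁) := by
    rw [← ofReal_mul, ← ofReal_exp]
    exact zero_le_real.2 (Real.exp_pos _).le
  simpa [mul_assoc, ← exp_add] using mul_nonneg hpos hexp

end PostWidder

/-! ### Landau's theorem and uniqueness of Laplace transforms -/

section Landau

variable {m : Measure ℝ} {W : ℝ → ℝ} {a c : ℝ}

lemma sum_taylor_le_of_iteratedDeriv_nonneg (hW : ContDiffOn ℝ ∞ W (Set.Ioi a))
    (hsign : ∀ (n : ℕ) (x : ℝ), a < x → 0 ≤ (-1 : ℝ) ^ n * iteratedDeriv n W x) {x x₀ : ℝ}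
    (hx : a < x) (hxx₀ : x < x₀) (n : ℕ) :
    ∑ k ∈ Finset.range n, (x₀ - x) ^ k / k.factorial * ((-1) ^ k * iteratedDeriv k W x₀) ≤
      W x := by
  rcases n with _ | n
  · simpa using hsign 0 x hx
  have hsub : Set.uIcc x₀ x ⊆ Set.Ioi a := by
    rw [Set.uIcc_of_ge hxx₀.le]
    exact fun y hy => hx.trans_le hy.1
  obtain ⟨y, hy, hrem⟩ := taylor_mean_remainder_lagrange_iteratedDeriv hxx₀.ne'
    ((hW.mono hsub).of_le (by exact_mod_cast le_top))
  have hneg : ∀ k : ℕ, (x - x₀) ^ k = (x₀ - x) ^ k * (-1) ^ k := fun k => by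
    rw [← mul_pow]; ring
  have hrem₀ : 0 ≤ iteratedDeriv (n + 1) W y * (x - x₀) ^ (n + 1) / (n + 1).factorial := by
    have hpow : 0 ≤ (x₀ - x) ^ (n + 1) := pow_nonneg (sub_nonneg.2 hxx₀.le) _
    rw [hneg, mul_left_comm, mul_comm (iteratedDeriv _ _ _)]
    exact div_nonneg (mul_nonneg hpow (hsign _ y (hsub (Set.uIoo_subset_uIcc_self hy))))
      (Nat.cast_nonneg _)
  rw [← hrem, taylor_within_apply, sub_nonneg] at hrem₀
  refine (Finset.sum_congr rfl fun k _ => ?_).trans_le hrem₀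
  rw [iteratedDerivWithin_eq_iteratedDeriv (uniqueDiffOn_uIcc hxx₀.ne')
    ((hW.contDiffAt (Ioi_mem_nhds (hx.trans hxx₀))).of_le (by exact_mod_cast le_top))
    Set.left_mem_uIcc, hneg, smul_eq_mul]
  ring

section

variable (hint : ∀ x : ℝ, c < x → Integrable (fun t : ℝ => Real.exp (-(x * t))) m)

include hint

lemma neg_mem_interior_integrableExpSet {x : ℝ} (hx : c < x) :
    -x ∈ interior (integrableExpSet id m) := by
  refine interior_maximal (t := Set.Iio (-c)) (fun y hy => ?_) isOpen_Iio (neg_lt_neg hx)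
  simpa [integrableExpSet] using hint (-y) (lt_neg.1 hy)

lemma integrable_pow_mul_exp_neg_mul (n : ℕ) {x : ℝ} (hx : c < x) :
    Integrable (fun t : ℝ => t ^ n * Real.exp (-(x * t))) m := by
  simpa using integrable_pow_mul_exp_of_mem_interior_integrableExpSet
    (neg_mem_interior_integrableExpSet hint hx) n

lemma iteratedDeriv_eq_of_eq_integral_exp
    (hW : ∀ x : ℝ, c < x → W x = ∫ t, Real.exp (-(x * t)) ∂m) (n : ℕ) {x : ℝ} (hx : c < x) :
    iteratedDeriv n W x = (-1) ^ n * ∫ t, t ^ n * Real.exp (-(x * t)) ∂m := by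
  have hmgf : W =ᶠ[𝓝 x] fun y => mgf id m (-y) := by
    filter_upwards [Ioi_mem_nhds hx] with y hy
    simp [hW y hy, mgf]
  rw [hmgf.iteratedDeriv_eq, iteratedDeriv_comp_neg,
    iteratedDeriv_mgf (neg_mem_interior_integrableExpSet hint hx)]
  simp

end

lemma ofReal_exp_neg_mul_eq_tsum {x x₀ t : ℝ} (hx : x ≤ x₀) (ht : 0 ≤ t) :
    ENNReal.ofReal (Real.exp (-(x * t))) = ∑' k : ℕ,
      ENNReal.ofReal ((x₀ - x) ^ k / k.factorial * (t ^ k * Real.exp (-(x₀ * t)))) := by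
  have hsum : HasSum (fun k : ℕ => (x₀ - x) ^ k / k.factorial * (t ^ k * Real.exp (-(x₀ * t))))
      (Real.exp (-(x * t))) := by
    have hexp := (NormedSpace.expSeries_div_hasSum_exp ((x₀ - x) * t)).mul_right
      (Real.exp (-(x₀ * t)))
    rw [← Real.exp_eq_exp_ℝ, ← Real.exp_add,
      show (x₀ - x) * t + -(x₀ * t) = -(x * t) by ring] at hexp
    exact hexp.congr_fun fun k => by rw [mul_pow]; ring
  have := sub_nonneg.2 hx
  rw [← hsum.tsum_eq, ENNReal.ofReal_tsum_of_nonneg (fun k => by positivity) hsum.summable]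

/- Landau's argument: all terms of the Taylor series of `W` at a point `x₀` to the right of `x`
are nonnegative, so that it may be summed under the integral sign. -/
theorem integrable_exp_neg_mul_of_iteratedDeriv_nonneg (hWs : ContDiffOn ℝ ∞ W (Set.Ioi a))
    (hsign : ∀ (n : ℕ) (x : ℝ), a < x → 0 ≤ (-1 : ℝ) ^ n * iteratedDeriv n W x)
    (hm : ∀ᵐ t ∂m, 0 ≤ t)
    (hint : ∀ x : ℝ, c < x → Integrable (fun t : ℝ => Real.exp (-(x * t))) m)
    (hW : ∀ x : ℝ, c < x → W x = ∫ t, Real.exp (-(x * t)) ∂m) {x : ℝ} (hx : a < x) :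
    Integrable (fun t : ℝ => Real.exp (-(x * t))) m := by
  obtain ⟨x₀, hx₀⟩ := exists_gt (max c x)
  obtain ⟨hcx₀, hxx₀⟩ := max_lt_iff.1 hx₀
  have := sub_nonneg.2 hxx₀.le
  have hterm : ∀ k : ℕ, ∫⁻ t, ENNReal.ofReal
      ((x₀ - x) ^ k / k.factorial * (t ^ k * Real.exp (-(x₀ * t)))) ∂m =
      ENNReal.ofReal ((x₀ - x) ^ k / k.factorial * ((-1) ^ k * iteratedDeriv k W x₀)) := fun k => by
    rw [← ofReal_integral_eq_lintegral_ofReal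
      ((integrable_pow_mul_exp_neg_mul hint k hcx₀).const_mul _)
      (hm.mono fun t ht => by positivity), integral_const_mul,
      iteratedDeriv_eq_of_eq_integral_exp hint hW k hcx₀, ← mul_assoc ((-1) ^ k), ← mul_pow]
    simp
  have hle : ∫⁻ t, ENNReal.ofReal (Real.exp (-(x * t))) ∂m ≤ ENNReal.ofReal (W x) := by
    rw [lintegral_congr_ae (hm.mono fun t ht => ofReal_exp_neg_mul_eq_tsum hxx₀.le ht),
      lintegral_tsum fun k => by fun_prop]
    refine ENNReal.tsum_le_of_sum_range_le fun n => ?_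
    simp_rw [hterm]
    rw [← ENNReal.ofReal_sum_of_nonneg fun k _ =>
      mul_nonneg (by positivity) (hsign k x₀ (hx.trans hxx₀))]
    exact ENNReal.ofReal_le_ofReal (sum_taylor_le_of_iteratedDeriv_nonneg hWs hsign hx hxx₀ n)
  refine ⟨by fun_prop, ?_⟩
  rw [hasFiniteIntegral_iff_ofReal (Eventually.of_forall fun t => (Real.exp_pos _).le)]
  exact hle.trans_lt ENNReal.ofReal_lt_top

end Landau

section LaplaceContinuation

lemma isOpen_re_gt (c : ℝ) : IsOpen {z : ℂ | c < z.re} := isOpen_lt continuous_const continuous_re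

lemma integral_exp_neg_ofReal_mul (m : Measure ℝ) (x : ℝ) :
    ∫ t : ℝ, exp (-((x : ℂ) * t)) ∂m = ((∫ t, Real.exp (-(x * t)) ∂m : ℝ) : ℂ) := by
  rw [← integral_complex_ofReal]
  push_cast
  rfl

lemma differentiableOn_integral_exp_neg_mul {m : Measure ℝ} {c : ℝ}
    (hint : ∀ x : ℝ, c < x → Integrable (fun t : ℝ => Real.exp (-(x * t))) m) :
    DifferentiableOn ℂ (fun z : ℂ => ∫ t : ℝ, exp (-(z * t)) ∂m) {z | c < z.re} := by
  refine ((differentiableOn_complexMGF (X := id) (μ := m)).comp (f := fun z : ℂ => -z)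
    differentiable_id.neg.differentiableOn
    fun z hz => neg_mem_interior_integrableExpSet hint hz).congr fun z _ => ?_
  simp [complexMGF]

lemma eqOn_re_gt_of_eq_ofReal {f g : ℂ → ℂ} {c d : ℝ} (hf : DifferentiableOn ℂ f {z | c < z.re})
    (hg : DifferentiableOn ℂ g {z | c < z.re}) (h : ∀ x : ℝ, d < x → f x = g x) :
    Set.EqOn f g {z | c < z.re} := by
  obtain ⟨y, hy⟩ := exists_gt (max c d)
  obtain ⟨hcy, hdy⟩ := max_lt_iff.1 hy
  refine AnalyticOnNhd.eqOn_of_preconnected_of_frequently_eq (hf.analyticOnNhd (isOpen_re_gt c))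
    (hg.analyticOnNhd (isOpen_re_gt c)) (convex_halfSpace_re_gt c).isPreconnected
    (z₀ := (y : ℂ)) (by simpa using hcy) ?_
  have hev : ∀ᶠ x : ℝ in 𝓝[≠] y, f x = g x :=
    eventually_nhdsWithin_of_eventually_nhds (by filter_upwards [Ioi_mem_nhds hdy] using h)
  exact (continuous_ofReal.continuousWithinAt.tendsto_nhdsWithin
    (fun x hx => ofReal_injective.ne hx)).frequently hev.frequently

lemma charFun_withDensity_exp_neg (m : Measure ℝ) (u : ℝ) :
    charFun (m.withDensity fun t => ENNReal.ofReal (Real.exp (-t))) u =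
      ∫ t : ℝ, exp (-((1 - u * I) * t)) ∂m := by
  rw [charFun_apply_real, integral_withDensity_eq_integral_toReal_smul (by fun_prop)
    (Eventually.of_forall fun t => ENNReal.ofReal_lt_top)]
  congr with t
  rw [ENNReal.toReal_ofReal (Real.exp_pos _).le, real_smul, ofReal_exp, ← exp_add]
  congr 1
  push_cast
  ring

theorem measure_ext_of_laplace {m₁ m₂ : Measure ℝ}
    (h₁ : ∀ x : ℝ, 0 < x → Integrable (fun t : ℝ => Real.exp (-(x * t))) m₁)
    (h₂ : ∀ x : ℝ, 0 < x → Integrable (fun t : ℝ => Real.exp (-(x * t))) m₂)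
    (h : ∀ x : ℝ, 0 < x → ∫ t, Real.exp (-(x * t)) ∂m₁ = ∫ t, Real.exp (-(x * t)) ∂m₂) :
    m₁ = m₂ := by
  have heq := eqOn_re_gt_of_eq_ofReal (differentiableOn_integral_exp_neg_mul h₁)
    (differentiableOn_integral_exp_neg_mul h₂) fun x hx => by
      rw [integral_exp_neg_ofReal_mul, integral_exp_neg_ofReal_mul, h x hx]
  set w : ℝ → ENNReal := fun t => ENNReal.ofReal (Real.exp (-t))
  have hfin : ∀ m : Measure ℝ, Integrable (fun t : ℝ => Real.exp (-(1 * t))) m →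
      IsFiniteMeasure (m.withDensity w) := fun m hm =>
    isFiniteMeasure_withDensity_ofReal (by simpa using hm.2)
  have := hfin m₁ (h₁ 1 one_pos)
  have := hfin m₂ (h₂ 1 one_pos)
  have hwd : m₁.withDensity w = m₂.withDensity w := by
    refine Measure.ext_of_charFun (funext fun u => ?_)
    rw [charFun_withDensity_exp_neg, charFun_withDensity_exp_neg]
    exact heq (by simp)
  have hinv : ∀ m : Measure ℝ, (m.withDensity w).withDensity (fun t => (w t)⁻¹) = m := fun m =>
    withDensity_inv_same (by fun_prop)
      (Eventually.of_forall fun t => (ENNReal.ofReal_pos.2 (Real.exp_pos _)).ne')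
      (Eventually.of_forall fun t => ENNReal.ofReal_ne_top)
  rw [← hinv m₁, hwd, hinv]

end LaplaceContinuation

/-! ### The representing measure -/

section AtomAndLebesgue

/-- The unit mass at `t₀` plus Lebesgue measure on `(t₀, ∞)`: a reference measure with respect to
which the possibly complex measure `ν δ_{t₀} + H(e^{-t}) dt` has a density. -/
noncomputable def atomAndLebesgue (t₀ : ℝ) : Measure ℝ :=
  Measure.dirac t₀ + volume.restrict (Set.Ioi t₀)

/-- The density of `ν δ_{t₀} + h(t) dt` with respect to `atomAndLebesgue t₀`. The value of `h` at
the atom is irrelevant and gets replaced by `ν`. -/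
noncomputable def withAtom (t₀ : ℝ) (ν : ℂ) (h : ℝ → ℂ) : ℝ → ℂ := Function.update h t₀ ν

variable {t₀ t : ℝ} {h e : ℝ → ℂ} (ν : ℂ)

instance (t₀ : ℝ) : IsLocallyFiniteMeasure (atomAndLebesgue t₀) :=
  ⟨fun t => ⟨Set.Icc (t - 1) (t + 1), Icc_mem_nhds (by simp) (by simp),
    ENNReal.add_lt_top.2 ⟨measure_lt_top _ _, isCompact_Icc.measure_lt_top⟩⟩⟩

lemma ae_le_atomAndLebesgue (t₀ : ℝ) : ∀ᵐ t ∂atomAndLebesgue t₀, t₀ ≤ t :=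
  ae_add_measure_iff.2 ⟨by simp [ae_dirac_eq],
    (ae_restrict_mem measurableSet_Ioi).mono fun _ ht => le_of_lt ht⟩

lemma atomAndLebesgue_pos_of_mem_nhds (ht : t₀ < t) {u : Set ℝ} (hu : u ∈ 𝓝 t) :
    0 < atomAndLebesgue t₀ u := by
  refine lt_of_lt_of_le ?_ (Measure.le_add_left le_rfl u)
  rw [Measure.restrict_apply' measurableSet_Ioi]
  exact Measure.measure_pos_of_mem_nhds _ (inter_mem hu (Ioi_mem_nhds ht))

lemma withAtom_of_lt (h : ℝ → ℂ) (ht : t₀ < t) : withAtom t₀ ν h t = h t :=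
  Function.update_of_ne ht.ne' _ _

lemma continuousAt_withAtom (hh : ContinuousOn h (Set.Ioi t₀)) (ht : t₀ < t) :
    ContinuousAt (withAtom t₀ ν h) t :=
  (hh.continuousAt (Ioi_mem_nhds ht)).congr
    (by filter_upwards [Ioi_mem_nhds ht] with s hs using (withAtom_of_lt ν h hs).symm)

lemma withAtom_mul_ae_eq (t₀ : ℝ) (h e : ℝ → ℂ) :
    (fun t => withAtom t₀ ν h t * e t) =ᵐ[volume.restrict (Set.Ioi t₀)] fun t => h t * e t := by
  filter_upwards [ae_restrict_mem measurableSet_Ioi] with t ht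
  rw [withAtom_of_lt ν h ht]

lemma integrable_withAtom_mul (hi : IntegrableOn (fun t => h t * e t) (Set.Ioi t₀)) :
    Integrable (fun t => withAtom t₀ ν h t * e t) (atomAndLebesgue t₀) :=
  integrable_add_measure.2
    ⟨integrable_dirac enorm_lt_top, (integrable_congr (withAtom_mul_ae_eq ν t₀ h e)).2 hi⟩

lemma integral_withAtom_mul (hi : IntegrableOn (fun t => h t * e t) (Set.Ioi t₀)) :
    ∫ t, withAtom t₀ ν h t * e t ∂atomAndLebesgue t₀ =
      ν * e t₀ + ∫ t in Set.Ioi t₀, h t * e t := by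
  obtain ⟨hdirac, hIoi⟩ := integrable_add_measure.1 (integrable_withAtom_mul ν hi)
  rw [atomAndLebesgue, integral_add_measure hdirac hIoi, integral_dirac,
    integral_congr_ae (withAtom_mul_ae_eq ν t₀ h e), withAtom, Function.update_self]

end AtomAndLebesgue

section RealDensity

variable {α : Type*} [MeasurableSpace α] {m : Measure α} {h : α → ℂ} {e : α → ℝ}
  (hmeas : AEMeasurable h m) (hh : ∀ᵐ x ∂m, 0 ≤ h x)

include hmeas hh

lemma integrable_withDensity_ofReal_re (hi : Integrable (fun x => h x * e x) m) :
    Integrable e (m.withDensity fun x => ENNReal.ofReal (h x).re) := by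
  have hre : AEMeasurable (fun x => ENNReal.ofReal (h x).re) m := hmeas.re.ennreal_ofReal
  rw [integrable_withDensity_iff_integrable_smul₀' hre
    (Eventually.of_forall fun x => ENNReal.ofReal_lt_top)]
  refine hi.re.congr (hh.mono fun x hx => ?_)
  simp [ENNReal.toReal_ofReal (nonneg_iff.1 hx).1]

lemma integral_withDensity_ofReal_re (e : α → ℝ) :
    ((∫ x, e x ∂m.withDensity fun x => ENNReal.ofReal (h x).re : ℝ) : ℂ) =
      ∫ x, h x * e x ∂m := by
  have hre : AEMeasurable (fun x => ENNReal.ofReal (h x).re) m := hmeas.re.ennreal_ofReal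
  rw [integral_withDensity_eq_integral_toReal_smul₀ hre
    (Eventually.of_forall fun x => ENNReal.ofReal_lt_top), ← integral_complex_ofReal]
  refine integral_congr_ae (hh.mono fun x hx => ?_)
  simp only [ENNReal.toReal_ofReal (nonneg_iff.1 hx).1, smul_eq_mul, ofReal_mul]
  rw [← eq_re_of_ofReal_le hx]

end RealDensity

section Representation

variable {p q : ℕ} {A a : Fin p → ℝ} {B b : Fin q → ℝ} {c φ₁ φ₂ : ℝ}

lemma reprMeasure_eq_add_withDensity_Ioi (c φ₁ φ₂ : ℝ) (A a : Fin p → ℝ) (B b : Fin q → ℝ) :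
    reprMeasure c φ₁ φ₂ A a B b =
      ENNReal.ofReal (nu A a B b) • Measure.dirac (-Real.log (rho A B)) +
        (volume.restrict (Set.Ioi (-Real.log (rho A B)))).withDensity
          fun t => ENNReal.ofReal (foxH c φ₁ φ₂ A a B b (Real.exp (-t))).re := by
  rw [reprMeasure, restrict_Ioi_eq_restrict_Ici]

lemma ae_le_reprMeasure (c φ₁ φ₂ : ℝ) (A a : Fin p → ℝ) (B b : Fin q → ℝ) :
    ∀ᵐ t ∂reprMeasure c φ₁ φ₂ A a B b, -Real.log (rho A B) ≤ t :=
  ae_add_measure_iff.2 ⟨Measure.ae_smul_measure (by simp [ae_dirac_eq]) _,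
    (withDensity_absolutelyContinuous _ _).ae_le (ae_restrict_mem measurableSet_Ici)⟩

lemma reprMeasure_restrict_Ici (c φ₁ φ₂ : ℝ) (A a : Fin p → ℝ) (B b : Fin q → ℝ) :
    (reprMeasure c φ₁ φ₂ A a B b).restrict (Set.Ici (-Real.log (rho A B))) =
      reprMeasure c φ₁ φ₂ A a B b :=
  Measure.restrict_eq_self_of_ae_mem (ae_le_reprMeasure c φ₁ φ₂ A a B b)

variable (hA : ∀ k, 0 < A k) (hB : ∀ j, 0 < B j) (hΔ : ∑ j, B j = ∑ k, A k) (hμ : mu a b = 0)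
  (hφ₁ : φ₁ < 0) (hφ₂ : 0 < φ₂) (hc : ∀ k, -a k / A k < c)

include hA hB hΔ hμ hφ₁ hφ₂ hc

theorem foxH_nonneg (hρ : rho A B ≤ 1) {d : ℝ}
    (hsign : ∀ (n : ℕ) (x : ℝ), d < x → 0 ≤ (-1 : ℝ) ^ n * iteratedDeriv n (gammaRatio A a B b) x)
    {t : ℝ} (ht : -Real.log (rho A B) < t) : 0 ≤ foxH c φ₁ φ₂ A a B b (Real.exp (-t)) := by
  have hlog : 0 ≤ -Real.log (rho A B) := neg_nonneg.2 (Real.log_nonpos (rho_pos hA hB).le hρ)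
  have hint : ∀ x : ℝ, max c d < x → _ := fun x hx =>
    integrableOn_foxH_mul_exp hA hB hΔ hμ hφ₁ hφ₂ hc ((le_max_left c d).trans_lt hx)
  rw [← withAtom_of_lt (nu A a B b) (fun t => foxH c φ₁ φ₂ A a B b (Real.exp (-t))) ht]
  refine nonneg_of_laplace_of_iteratedDeriv_nonneg (c := max c d)
    ((ae_le_atomAndLebesgue _).mono fun s hs => hlog.trans hs)
    (fun x hx => integrable_withAtom_mul _ (hint x hx)) (fun x hx => ?_)
    (fun n x hx => hsign n x ((le_max_right c d).trans_lt hx)) (hlog.trans_lt ht)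
    (fun u hu => atomAndLebesgue_pos_of_mem_nhds ht hu)
    (continuousAt_withAtom _ (continuousOn_foxH_exp_neg hA hB hΔ hμ hφ₁ hφ₂ hc) ht)
  rw [integral_withAtom_mul _ (hint x hx)]
  exact gammaRatio_eq_add_integral_foxH hA hB hΔ hμ hφ₁ hφ₂ hc ((le_max_left c d).trans_lt hx)

variable
  (hH : ∀ t, -Real.log (rho A B) < t → 0 ≤ foxH c φ₁ φ₂ A a B b (Real.exp (-t)))

include hH

theorem laplace_reprMeasure {x : ℝ} (hx : c < x) :
    Integrable (fun t : ℝ => Real.exp (-(x * t))) (reprMeasure c φ₁ φ₂ A a B b) ∧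
      gammaRatio A a B b x = ∫ t, Real.exp (-(x * t)) ∂reprMeasure c φ₁ φ₂ A a B b := by
  have hmeas := (continuousOn_foxH_exp_neg hA hB hΔ hμ hφ₁ hφ₂ hc).aemeasurable
    (μ := volume) measurableSet_Ioi
  have hnonneg : ∀ᵐ t ∂volume.restrict (Set.Ioi (-Real.log (rho A B))),
      0 ≤ foxH c φ₁ φ₂ A a B b (Real.exp (-t)) := (ae_restrict_mem measurableSet_Ioi).mono hH
  have hexp : ∀ t : ℝ, exp (-((x : ℂ) * t)) = (Real.exp (-(x * t)) : ℝ) := fun t => by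
    push_cast
    rfl
  have hi := integrableOn_foxH_mul_exp hA hB hΔ hμ hφ₁ hφ₂ hc hx
  have hrepr := gammaRatio_eq_add_integral_foxH hA hB hΔ hμ hφ₁ hφ₂ hc hx
  simp_rw [hexp] at hi hrepr
  have hatom : Integrable (fun t => Real.exp (-(x * t)))
      (ENNReal.ofReal (nu A a B b) • Measure.dirac (-Real.log (rho A B))) :=
    (integrable_dirac enorm_lt_top).smul_measure ENNReal.ofReal_ne_top
  have hdens := integrable_withDensity_ofReal_re hmeas hnonneg hi
  rw [reprMeasure_eq_add_withDensity_Ioi]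
  refine ⟨integrable_add_measure.2 ⟨hatom, hdens⟩, ofReal_injective ?_⟩
  rw [hrepr, integral_add_measure hatom hdens, ofReal_add,
    integral_withDensity_ofReal_re hmeas hnonneg, integral_smul_measure, integral_dirac,
    ENNReal.toReal_ofReal (nu_pos hA hB a b).le, smul_eq_mul, ofReal_mul]

end Representation

section RemovableSingularities

variable {p q : ℕ} {A a : Fin p → ℝ} {B b : Fin q → ℝ}

lemma gammaRatio_eq_div_prod_inv (A a : Fin p → ℝ) (B b : Fin q → ℝ) (x : ℝ) :
    (gammaRatio A a B b x : ℂ) = (∏ j, (Gamma (B j * x + b j))⁻¹) /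
      ∏ k, (Gamma (A k * x + a k))⁻¹ := by
  rw [← gammaRatioC_ofReal, gammaRatioC, Finset.prod_inv_distrib, Finset.prod_inv_distrib,
    div_inv_eq_mul, inv_mul_eq_div]

lemma prod_inv_Gamma_ne_zero {x : ℝ} (hx : ∀ (k : Fin p) (n : ℕ), A k * x + a k ≠ -(n : ℝ)) :
    ∏ k, (Gamma (A k * x + a k))⁻¹ ≠ 0 :=
  Finset.prod_ne_zero_iff.2 fun k _ =>
    inv_ne_zero (Gamma_ne_zero fun n h => hx k n (by exact_mod_cast h))

lemma affine_ne_neg_nat_of_lt (hA : ∀ k, 0 < A k) {c : ℝ} (hc : ∀ k, -a k / A k < c) {x : ℝ}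
    (hx : c < x) (k : Fin p) (n : ℕ) : A k * x + a k ≠ -(n : ℝ) := by
  exact_mod_cast affine_ne_neg_nat hA hc (s := x) (Or.inr hx.le) k n

lemma dense_affine_ne_neg_nat (hA : ∀ k, 0 < A k) (a : Fin p → ℝ) :
    Dense {x : ℝ | ∀ (k : Fin p) (n : ℕ), A k * x + a k ≠ -(n : ℝ)} := by
  have hcount : (Set.range fun z : Fin p × ℕ => (-(z.2 : ℝ) - a z.1) / A z.1).Countable :=
    Set.countable_range _
  refine Dense.mono (fun x hx => ?_) (hcount.dense_compl ℝ)
  exact fun k n h => hx ⟨(k, n), (div_eq_iff (hA k).ne').2 (by linarith)⟩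

variable {m : Measure ℝ} {c d : ℝ}
  (hint : ∀ x : ℝ, d < x → Integrable (fun t : ℝ => Real.exp (-(x * t))) m)
  (hA : ∀ k, 0 < A k) (hc : ∀ k, -a k / A k < c)
  (hL : ∀ x : ℝ, c < x → gammaRatio A a B b x = ∫ t, Real.exp (-(x * t)) ∂m)

include hint hA hc hL

lemma gammaRatio_eq_integral_exp_of_ne_neg_nat {x : ℝ} (hx : d < x)
    (hne : ∀ (k : Fin p) (n : ℕ), A k * x + a k ≠ -(n : ℝ)) :
    gammaRatio A a B b x = ∫ t, Real.exp (-(x * t)) ∂m := by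
  have heq : (∏ k, (Gamma (A k * x + a k))⁻¹) * ∫ t : ℝ, exp (-(x * t)) ∂m =
      ∏ j, (Gamma (B j * x + b j))⁻¹ :=
    eqOn_re_gt_of_eq_ofReal
      ((differentiable_prod_inv_Gamma A a).differentiableOn.mul
        (differentiableOn_integral_exp_neg_mul hint))
      (differentiable_prod_inv_Gamma B b).differentiableOn (fun y (hy : c < y) => by
        rw [Pi.mul_apply, integral_exp_neg_ofReal_mul, ← hL y hy, gammaRatio_eq_div_prod_inv,
          mul_div_cancel₀ _ (prod_inv_Gamma_ne_zero (affine_ne_neg_nat_of_lt hA hc hy))])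
      (show (x : ℂ) ∈ {z : ℂ | d < z.re} from hx)
  rw [← ofReal_inj, ← integral_exp_neg_ofReal_mul, gammaRatio_eq_div_prod_inv, ← heq,
    mul_div_cancel_left₀ _ (prod_inv_Gamma_ne_zero hne)]

theorem eqOn_integral_exp_of_eq_gammaRatio {W : ℝ → ℝ}
    (hW : ∀ x : ℝ, d < x → (∀ (k : Fin p) (n : ℕ), A k * x + a k ≠ -(n : ℝ)) →
      W x = gammaRatio A a B b x) (hWc : ContinuousOn W (Set.Ioi d)) :
    Set.EqOn W (fun x => ∫ t, Real.exp (-(x * t)) ∂m) (Set.Ioi d) := by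
  have hcont : ContinuousOn (fun x : ℝ => ∫ t, Real.exp (-(x * t)) ∂m) (Set.Ioi d) := by
    refine ((continuousOn_mgf (X := id)).comp continuousOn_neg fun x hx =>
      neg_mem_interior_integrableExpSet hint hx).congr fun x _ => ?_
    simp [mgf]
  refine Set.EqOn.of_subset_closure (fun x hx => ?_) hWc hcont Set.inter_subset_left
    ((dense_affine_ne_neg_nat hA a).open_subset_closure_inter isOpen_Ioi)
  exact (hW x hx.1 hx.2).trans (gammaRatio_eq_integral_exp_of_ne_neg_nat hint hA hc hL hx.1 hx.2)

end RemovableSingularities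

end FoxH

open FoxH MeasureTheory

theorem corollary2p1 {p q : ℕ} (A a : Fin p → ℝ) (B b : Fin q → ℝ)
    (hA : ∀ k, 0 < A k) (hB : ∀ j, 0 < B j)
    (hΔ : (∑ j, B j) - (∑ k, A k) = 0) (hμ : FoxH.mu a b = 0) (hρ : FoxH.rho A B ≤ 1)
    -- `W` is the gamma ratio on `(0, ∞)`, with its removable singularities filled in
    (W : ℝ → ℝ)
    (hW : ∀ x : ℝ, 0 < x → (∀ (k : Fin p) (n : ℕ), A k * x + a k ≠ -(n : ℝ)) →
      W x = FoxH.gammaRatio A a B b x)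
    (hWcm : FoxH.IsCompletelyMonotonic W)
    -- an arbitrary left loop around the poles of the integrand that defines `H`
    (c φ₁ φ₂ : ℝ) (hφ₁ : φ₁ < 0) (hφ₂ : 0 < φ₂) (hc : ∀ k, -a k / A k < c) :
    -- `H` is real and nonnegative on `(0, ρ)`
    (∀ x : ℝ, 0 < x → x < FoxH.rho A B →
      (FoxH.foxH c φ₁ φ₂ A a B b x).im = 0 ∧ 0 ≤ (FoxH.foxH c φ₁ φ₂ A a B b x).re) ∧
    -- the measure `ν δ_{-log ρ} + H(e^{-t}) dt` represents `W`
    (∀ x : ℝ, 0 < x →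
      MeasureTheory.IntegrableOn (fun t : ℝ => Real.exp (-(x * t)))
        (Set.Ici (-Real.log (FoxH.rho A B))) (FoxH.reprMeasure c φ₁ φ₂ A a B b) ∧
      W x = ∫ t in Set.Ici (-Real.log (FoxH.rho A B)), Real.exp (-(x * t))
        ∂(FoxH.reprMeasure c φ₁ φ₂ A a B b)) ∧
    -- it is the only measure on `[0, ∞)` that represents `W`
    (∀ m : MeasureTheory.Measure ℝ, m (Set.Iio 0) = 0 →
      (∀ x : ℝ, 0 < x → MeasureTheory.Integrable (fun t : ℝ => Real.exp (-(x * t))) m ∧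
        W x = ∫ t, Real.exp (-(x * t)) ∂m) →
      m = FoxH.reprMeasure c φ₁ φ₂ A a B b) := by
  have hΔ' : ∑ j, B j = ∑ k, A k := sub_eq_zero.1 hΔ
  have hlog : 0 ≤ -Real.log (rho A B) := neg_nonneg.2 (Real.log_nonpos (rho_pos hA hB).le hρ)
  have hWΓ : ∀ x, max c 0 < x → W x = gammaRatio A a B b x := fun x hx =>
    hW x ((le_max_right c 0).trans_lt hx)
      (affine_ne_neg_nat_of_lt hA hc ((le_max_left c 0).trans_lt hx))
  have hsign : ∀ n x, max c 0 < x → 0 ≤ (-1 : ℝ) ^ n * iteratedDeriv n (gammaRatio A a B b) x := by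
    intro n x hx
    rw [← (Set.EqOn.eventuallyEq_of_mem hWΓ (Ioi_mem_nhds hx)).iteratedDeriv_eq n]
    exact hWcm.2.2 n x ((le_max_right c 0).trans_lt hx)
  have hH := fun t => foxH_nonneg hA hB hΔ' hμ hφ₁ hφ₂ hc hρ hsign (t := t)
  have hright := fun x => laplace_reprMeasure hA hB hΔ' hμ hφ₁ hφ₂ hc hH (x := x)
  have hint : ∀ x, 0 < x → Integrable (fun t => Real.exp (-(x * t)))
      (reprMeasure c φ₁ φ₂ A a B b) := fun x hx =>
    integrable_exp_neg_mul_of_iteratedDeriv_nonneg hWcm.2.1 hWcm.2.2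
      ((ae_le_reprMeasure c φ₁ φ₂ A a B b).mono fun t ht => hlog.trans ht)
      (fun x hx => (hright x ((le_max_left c 0).trans_lt hx)).1)
      (fun x hx => (hWΓ x hx).trans (hright x ((le_max_left c 0).trans_lt hx)).2) hx
  have hrep := eqOn_integral_exp_of_eq_gammaRatio hint hA hc (fun x hx => (hright x hx).2) hW
    hWcm.2.1.continuousOn
  refine ⟨fun x hx hxρ => ?_, fun x hx => ⟨(hint x hx).integrableOn, ?_⟩, fun m _ hm => ?_⟩
  · have hnonneg := Complex.nonneg_iff.1 (hH (-Real.log x) (neg_lt_neg (Real.log_lt_log hx hxρ)))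
    rw [neg_neg, Real.exp_log hx] at hnonneg
    exact ⟨hnonneg.2.symm, hnonneg.1⟩
  · rw [reprMeasure_restrict_Ici, hrep hx]
  · exact measure_ext_of_laplace (fun x hx => (hm x hx).1) hint
      fun x hx => (hm x hx).2.symm.trans (hrep hx)
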